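/- Index sequences by $n\in\mathbb N=\{1,2,\dots\}$. Let $s$ be the Fréchet space of rapidly decreasing complex sequences, with norms $|\xi|_q=\big(\sum_j|\xi_j|^2j^{2q}\big)^{1/2}$, $q\in\mathbb N_0$, and let $s'=\{\xi:|\xi|'_q:=\big(\sum_j|\xi_j|^2j^{-2q}\big)^{1/2}<\infty\text{ for some }q\in\mathbb N_0\}$ with its inductive limit topology. Let $L(s',s)$ be the algebra of continuous linear operators $s'\to s$, with multiplication $xy=x\circ j\circ y$ ($j:s\hookrightarrow s'$ the inclusion), the topology given by the norms $\|x\|_q=\sup_{|\xi|'_q\le1}|x\xi|_q$, and the Hilbertian involution $x\mapsto x^*$ determined by $\langle x\xi,\eta\rangle=\langle\xi,x^*\eta\rangle$, where $\langle\xi,\eta\rangle=\sum_j\xi_j\overline{\eta_j}$. For $x\in L(s',s)$ let $\sigma(x)$ be its spectrum, taken in the unitization of $L(s',s)$, and let $\operatorname{alg}(x)$ be the closed ${}^*$-subalgebra of $L(s',s)$ generated by $x$. Theorem. Let $x\in L(s',s)$ be normal ($xx^*=x^*x$) and infinite dimensional (its range is infinite dimensional). Then $x$ has a spectral representation $x=\sum_{n=1}^\infty\lambda_nP_n$,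 that is: the $\lambda_n$ are nonzero pairwise different complex numbers with $|\lambda_1|\ge|\lambda_2|\ge\dots$, the $P_n\in L(s',s)$ are nonzero pairwise orthogonal finite dimensional projections ($P_n=P_n^2=P_n^*$), and the series converges to $x$ in $L(s',s)$. For every such representation put $$C_s(\sigma(x))=\Big\{f:\sigma(x)\to\mathbb C:\ f(0)=0,\ c_q(f):=\sup_n|f(\lambda_n)|\,\|P_n\|_q<\infty\ \text{ for all }q\in\mathbb N_0\Big\},$$ with pointwise operations, complex conjugation, and the topology given by the seminorms $c_q$. Then $C_s(\sigma(x))$ and $\operatorname{alg}(x)$ are Fréchet algebras (complete metrizable locally convex spaces with continuous multiplication), for every $f\in C_s(\sigma(x))$ the series $f(x):=\sum_{n=1}^\infty f(\lambda_n)P_n$ converges unconditionally in $L(s',s)$, and $$\Phi:C_s(\sigma(x))\to\operatorname{alg}(x),\qquad \Phi(f)=f(x),$$ is an isomorphism of Fréchet algebras (an algebra isomorphism onto $\operatorname{alg}(x)$ that is a homeomorphism). Moreover the identity function $\mathrm{id}$ belongs to $C_s(\sigma(x))$, $\Phi(\mathrm{id})=x$, and $\Phi(\overline f)=\Phi(f)^*$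 for all $f\in C_s(\sigma(x))$. -/

import Mathlib

open scoped Topology
open Filter

noncomputable section

/-! ### Weighted square-summable sequences

Sequences are indexed by `ℕ = {0, 1, 2, …}`, so the index `j` here stands for the
natural number `j + 1` of the usual convention `{1, 2, …}`. -/

/-- `∑ |ξ_j|² j^{2m} < ∞` (with `j + 1` in the role of `j`). -/
def WSummable (m : ℤ) (ξ : ℕ → ℂ) : Prop :=
  Summable fun j : ℕ => ‖ξ j‖ ^ 2 * ((j : ℝ) + 1) ^ (2 * m)

/-- `(∑ |ξ_j|² j^{2m})^{1/2}`; this is `|ξ|_q` for `m = q` and `|ξ|'_q` for `m = -q`. -/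
def wnorm (m : ℤ) (ξ : ℕ → ℂ) : ℝ :=
  Real.sqrt (∑' j : ℕ, ‖ξ j‖ ^ 2 * ((j : ℝ) + 1) ^ (2 * m))

/-- The weighted sequence `(j^m ξ_j)`. -/
def wseq (m : ℤ) (ξ : ℕ → ℂ) : ℕ → ℂ := fun j => (((((j : ℝ) + 1) ^ m : ℝ)) : ℂ) * ξ j

theorem norm_wseq_sq (m : ℤ) (ξ : ℕ → ℂ) (j : ℕ) :
    ‖wseq m ξ j‖ ^ 2 = ‖ξ j‖ ^ 2 * ((j : ℝ) + 1) ^ (2 * m) := by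
  have h : (0 : ℝ) < (j : ℝ) + 1 := by positivity
  have h2 : ‖wseq m ξ j‖ = ((j : ℝ) + 1) ^ m * ‖ξ j‖ := by
    unfold wseq
    rw [norm_mul, Complex.norm_real, Real.norm_of_nonneg (by positivity)]
  rw [h2, mul_pow, two_mul, zpow_add₀ h.ne']
  ring

theorem memlp_wseq {m : ℤ} {ξ : ℕ → ℂ} : Memℓp (wseq m ξ) 2 ↔ WSummable m ξ := by
  rw [memℓp_gen_iff (by norm_num)]
  unfold WSummable
  refine summable_congr fun j => ?_
  rw [← norm_wseq_sq]
  norm_num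

theorem wseq_add (m : ℤ) (ξ η : ℕ → ℂ) : wseq m (ξ + η) = wseq m ξ + wseq m η := by
  funext j; simp [wseq, mul_add]

theorem wseq_smul (m : ℤ) (c : ℂ) (ξ : ℕ → ℂ) : wseq m (c • ξ) = c • wseq m ξ := by
  funext j; simp [wseq]; ring

/-- The weighted sequence as an element of `ℓ²`. -/
def wl2 (m : ℤ) (ξ : ℕ → ℂ) (h : WSummable m ξ) : lp (fun _ : ℕ => ℂ) 2 :=
  ⟨wseq m ξ, memlp_wseq.2 h⟩

theorem norm_wl2 {m : ℤ} {ξ : ℕ → ℂ} (h : WSummable m ξ) : ‖wl2 m ξ h‖ = wnorm m ξ := by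
  rw [lp.norm_eq_tsum_rpow (by norm_num)]
  unfold wnorm
  rw [Real.sqrt_eq_rpow]
  simp only [← norm_wseq_sq]
  norm_num [wl2]

theorem WSummable.add {m : ℤ} {ξ η : ℕ → ℂ} (h : WSummable m ξ) (h' : WSummable m η) :
    WSummable m (ξ + η) := by
  rw [← memlp_wseq, wseq_add]
  exact (memlp_wseq.2 h).add (memlp_wseq.2 h')

theorem WSummable.smul {m : ℤ} {ξ : ℕ → ℂ} (c : ℂ) (h : WSummable m ξ) :
    WSummable m (c • ξ) := by
  rw [← memlp_wseq, wseq_smul]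
  exact (memlp_wseq.2 h).const_smul c

theorem WSummable.zero (m : ℤ) : WSummable m 0 := by
  simp [WSummable, summable_zero]

theorem wnorm_nonneg (m : ℤ) (ξ : ℕ → ℂ) : 0 ≤ wnorm m ξ := Real.sqrt_nonneg _

theorem wnorm_zero (m : ℤ) : wnorm m 0 = 0 := by simp [wnorm]

theorem wnorm_add_le {m : ℤ} {ξ η : ℕ → ℂ} (h : WSummable m ξ) (h' : WSummable m η) :
    wnorm m (ξ + η) ≤ wnorm m ξ + wnorm m η := by
  rw [← norm_wl2 h, ← norm_wl2 h', ← norm_wl2 (h.add h')]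
  have : wl2 m (ξ + η) (h.add h') = wl2 m ξ h + wl2 m η h' := by
    apply Subtype.ext; exact wseq_add m ξ η
  rw [this]
  exact norm_add_le _ _

theorem wnorm_smul (m : ℤ) (c : ℂ) (ξ : ℕ → ℂ) : wnorm m (c • ξ) = ‖c‖ * wnorm m ξ := by
  unfold wnorm
  have : ∀ j : ℕ, ‖(c • ξ) j‖ ^ 2 * ((j : ℝ) + 1) ^ (2 * m)
      = ‖c‖ ^ 2 * (‖ξ j‖ ^ 2 * ((j : ℝ) + 1) ^ (2 * m)) := by
    intro j; simp [mul_pow, mul_assoc]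
  simp only [this, tsum_mul_left]
  rw [Real.sqrt_mul (by positivity), Real.sqrt_sq (norm_nonneg _)]

theorem weight_le {m m' : ℤ} (hm : m ≤ m') (j : ℕ) :
    ((j : ℝ) + 1) ^ (2 * m) ≤ ((j : ℝ) + 1) ^ (2 * m') :=
  zpow_le_zpow_right₀ (by linarith [(Nat.cast_nonneg j : (0 : ℝ) ≤ j)]) (by omega)

theorem WSummable.mono {m m' : ℤ} (hm : m ≤ m') {ξ : ℕ → ℂ} (h : WSummable m' ξ) :
    WSummable m ξ :=
  Summable.of_nonneg_of_le (fun j => by positivity)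
    (fun j => mul_le_mul_of_nonneg_left (weight_le hm j) (by positivity)) h

theorem wnorm_mono {m m' : ℤ} (hm : m ≤ m') {ξ : ℕ → ℂ} (h : WSummable m' ξ) :
    wnorm m ξ ≤ wnorm m' ξ :=
  Real.sqrt_le_sqrt ((h.mono hm).tsum_le_tsum
    (fun j => mul_le_mul_of_nonneg_left (weight_le hm j) (by positivity)) h)

/-- If every term is dominated by `K² (j+1)^{-2}`, the weighted norm is at most a multiple of `K`. -/
theorem wnorm_le_of_coord {m : ℤ} {ξ : ℕ → ℂ} {K : ℝ} (hK : 0 ≤ K)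
    (h : ∀ j : ℕ, ‖ξ j‖ ≤ K * ((j : ℝ) + 1) ^ (-(m + 1))) :
    WSummable m ξ ∧
      wnorm m ξ ≤ Real.sqrt (∑' j : ℕ, ((j : ℝ) + 1) ^ (-2 : ℤ)) * K := by
  have hs : Summable fun j : ℕ => ((j : ℝ) + 1) ^ (-2 : ℤ) := by
    have := (summable_nat_add_iff 1).2 (Real.summable_nat_pow_inv (p := 2).2 (by norm_num))
    refine this.congr fun j => ?_
    rw [zpow_neg]; push_cast; norm_cast
  have hb : ∀ j : ℕ, ‖ξ j‖ ^ 2 * ((j : ℝ) + 1) ^ (2 * m)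
      ≤ K ^ 2 * ((j : ℝ) + 1) ^ (-2 : ℤ) := by
    intro j
    have hj : (0 : ℝ) < (j : ℝ) + 1 := by positivity
    calc ‖ξ j‖ ^ 2 * ((j : ℝ) + 1) ^ (2 * m)
        ≤ (K * ((j : ℝ) + 1) ^ (-(m + 1))) ^ 2 * ((j : ℝ) + 1) ^ (2 * m) := by
          gcongr; exact h j
      _ = K ^ 2 * ((((j : ℝ) + 1) ^ (-(m + 1)) * ((j : ℝ) + 1) ^ (-(m + 1)))
            * ((j : ℝ) + 1) ^ (2 * m)) := by ring
      _ = K ^ 2 * ((j : ℝ) + 1) ^ (-2 : ℤ) := by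
          rw [← zpow_add₀ hj.ne', ← zpow_add₀ hj.ne']; congr 2; ring
  have hsum : WSummable m ξ :=
    Summable.of_nonneg_of_le (fun j => by positivity) hb (hs.mul_left _)
  refine ⟨hsum, ?_⟩
  calc wnorm m ξ ≤ Real.sqrt (∑' j : ℕ, K ^ 2 * ((j : ℝ) + 1) ^ (-2 : ℤ)) :=
        Real.sqrt_le_sqrt (hsum.tsum_le_tsum hb (hs.mul_left _))
    _ = _ := by
        rw [tsum_mul_left, Real.sqrt_mul (by positivity), Real.sqrt_sq hK, mul_comm]

/-- Cauchy–Schwarz for `⟨ξ, η⟩ = ∑ ξ_j conj η_j`. -/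
theorem pairing_bound {m : ℤ} {ξ η : ℕ → ℂ} (h : WSummable m ξ) (h' : WSummable (-m) η) :
    Summable (fun j => ξ j * star (η j)) ∧
      ‖∑' j, ξ j * star (η j)‖ ≤ wnorm m ξ * wnorm (-m) η := by
  have hs := lp.hasSum_inner (𝕜 := ℂ) (wl2 (-m) η h') (wl2 m ξ h)
  have he : ∀ j, inner ℂ (wl2 (-m) η h' j) (wl2 m ξ h j) = ξ j * star (η j) := by
    intro j
    have hj : (((j : ℝ) + 1) ^ m : ℝ) ≠ 0 := by positivity
    simp only [wl2, wseq, RCLike.inner_apply, map_mul, Complex.conj_ofReal]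
    rw [zpow_neg]
    push_cast
    have hj' : ((j : ℂ) + 1) ^ m ≠ 0 := zpow_ne_zero _ (Nat.cast_add_one_ne_zero j)
    field_simp
    rfl
  simp only [he] at hs
  refine ⟨hs.summable, ?_⟩
  rw [hs.tsum_eq, ← norm_wl2 h, ← norm_wl2 h', mul_comm]
  exact norm_inner_le_norm _ _

/-! ### The spaces `s` and `s'` -/

/-- Rapidly decreasing sequences, as a subspace of all complex sequences. -/
def rapidSubmodule : Submodule ℂ (ℕ → ℂ) where
  carrier := {ξ | ∀ q : ℕ, WSummable q ξ}
  add_mem' h h' q := (h q).add (h' q)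
  zero_mem' q := WSummable.zero q
  smul_mem' c _ h q := (h q).smul c

/-- Slowly increasing sequences, as a subspace of all complex sequences. -/
def slowSubmodule : Submodule ℂ (ℕ → ℂ) where
  carrier := {ξ | ∃ q : ℕ, WSummable (-(q : ℤ)) ξ}
  add_mem' := by
    rintro ξ η ⟨q, h⟩ ⟨q', h'⟩
    exact ⟨max q q', (h.mono (by simp)).add (h'.mono (by simp))⟩
  zero_mem' := ⟨0, WSummable.zero _⟩
  smul_mem' := by
    rintro c ξ ⟨q, h⟩
    exact ⟨q, h.smul c⟩

/-- The space `s` of rapidly decreasing sequences. -/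
def RapidSeq : Type := ↥rapidSubmodule

/-- The space `s'` of slowly increasing sequences. -/
def SlowSeq : Type := ↥slowSubmodule

namespace RapidSeq

instance : AddCommGroup RapidSeq := inferInstanceAs (AddCommGroup ↥rapidSubmodule)
instance : Module ℂ RapidSeq := inferInstanceAs (Module ℂ ↥rapidSubmodule)

/-- The underlying sequence of an element of `s`. -/
def coords : RapidSeq →ₗ[ℂ] (ℕ → ℂ) := rapidSubmodule.subtype

instance : CoeFun RapidSeq fun _ => ℕ → ℂ := ⟨fun ξ => coords ξ⟩

/-- The element of `s` given by a rapidly decreasing sequence. -/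
def mk (ξ : ℕ → ℂ) (h : ∀ q : ℕ, WSummable q ξ) : RapidSeq := ⟨ξ, h⟩

@[simp] theorem coords_mk (ξ : ℕ → ℂ) (h : ∀ q : ℕ, WSummable q ξ) : coords (mk ξ h) = ξ := rfl

theorem summable (ξ : RapidSeq) (q : ℕ) : WSummable q (coords ξ) := ξ.2 q

theorem ext {ξ η : RapidSeq} (h : coords ξ = coords η) : ξ = η := Subtype.ext h

/-- The norm `|ξ|_q` on `s`. -/
def norm (q : ℕ) : Seminorm ℂ RapidSeq :=
  Seminorm.of (fun ξ => wnorm q (coords ξ))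
    (fun ξ η => by rw [map_add]; exact wnorm_add_le (ξ.summable q) (η.summable q))
    (fun c ξ => by rw [map_smul]; exact wnorm_smul q c _)

theorem norm_apply (q : ℕ) (ξ : RapidSeq) : norm q ξ = wnorm q (coords ξ) := rfl

/-- The topology of `s` is given by the norms `|·|_q`. -/
instance : TopologicalSpace RapidSeq :=
  (SeminormFamily.moduleFilterBasis (norm : SeminormFamily ℂ RapidSeq ℕ)).topology

theorem withSeminorms : WithSeminorms (norm : SeminormFamily ℂ RapidSeq ℕ) := ⟨rfl⟩

instance : IsTopologicalAddGroup RapidSeq := withSeminorms.topologicalAddGroup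
instance : ContinuousSMul ℂ RapidSeq := withSeminorms.continuousSMul

end RapidSeq

namespace SlowSeq

instance : AddCommGroup SlowSeq := inferInstanceAs (AddCommGroup ↥slowSubmodule)
instance : Module ℂ SlowSeq := inferInstanceAs (Module ℂ ↥slowSubmodule)

/-- The underlying sequence of an element of `s'`. -/
def coords : SlowSeq →ₗ[ℂ] (ℕ → ℂ) := slowSubmodule.subtype

instance : CoeFun SlowSeq fun _ => ℕ → ℂ := ⟨fun ξ => coords ξ⟩

/-- The element of `s'` given by a slowly increasing sequence. -/
def mk (ξ : ℕ → ℂ) (h : ∃ q : ℕ, WSummable (-(q : ℤ)) ξ) : SlowSeq := ⟨ξ, h⟩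

@[simp] theorem coords_mk (ξ : ℕ → ℂ) (h : ∃ q : ℕ, WSummable (-(q : ℤ)) ξ) :
    coords (mk ξ h) = ξ := rfl

theorem summable (ξ : SlowSeq) : ∃ q : ℕ, WSummable (-(q : ℤ)) (coords ξ) := ξ.2

theorem ext {ξ η : SlowSeq} (h : coords ξ = coords η) : ξ = η := Subtype.ext h

/-- The seminorms on `s'` that are continuous on each of the normed spaces
`{ξ : |ξ|'_q < ∞}` with norm `|·|'_q`. -/
def StepContinuous : Type :=
  {p : Seminorm ℂ SlowSeq // ∀ q : ℕ, ∃ C : ℝ, ∀ ξ : SlowSeq,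
    WSummable (-(q : ℤ)) (coords ξ) → p ξ ≤ C * wnorm (-(q : ℤ)) (coords ξ)}

instance : Inhabited StepContinuous :=
  ⟨⟨0, fun _ => ⟨0, fun ξ _ => by simp⟩⟩⟩

/-- The family of all seminorms that are continuous on the steps. -/
def seminorms : SeminormFamily ℂ SlowSeq StepContinuous := fun p => p.1

theorem seminorms_bound (p : StepContinuous) (q : ℕ) : ∃ C : ℝ, 0 < C ∧ ∀ ξ : SlowSeq,
    WSummable (-(q : ℤ)) (coords ξ) → seminorms p ξ ≤ C * wnorm (-(q : ℤ)) (coords ξ) := by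
  obtain ⟨C, hC⟩ := p.2 q
  exact ⟨|C| + 1, by positivity, fun η hη =>
    (hC η hη).trans (mul_le_mul_of_nonneg_right (by linarith [le_abs_self C]) (wnorm_nonneg _ _))⟩

/-- The (locally convex) inductive limit topology on `s'`: the finest locally convex topology for
which the inclusions of all steps `{ξ : |ξ|'_q < ∞}` are continuous, that is, the one given by
all seminorms whose restrictions to the steps are continuous. -/
instance : TopologicalSpace SlowSeq := seminorms.moduleFilterBasis.topology

theorem withSeminorms : WithSeminorms seminorms := ⟨rfl⟩

instance : IsTopologicalAddGroup SlowSeq := withSeminorms.topologicalAddGroup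
instance : ContinuousSMul ℂ SlowSeq := withSeminorms.continuousSMul

theorem single_wSummable' (m : ℤ) (j : ℕ) : WSummable m (Pi.single j 1) :=
  summable_of_ne_finset_zero (s := {j}) (fun k hk => by
    have : k ≠ j := by simpa using hk
    simp [Pi.single_eq_of_ne this])

/-- The unit sequence `e_j`. -/
def single (j : ℕ) : SlowSeq := mk (Pi.single j 1) ⟨0, single_wSummable' _ j⟩

theorem single_wSummable (m : ℤ) (j : ℕ) : WSummable m (coords (single j)) :=
  single_wSummable' m j

theorem single_wnorm (m : ℤ) (j : ℕ) : wnorm m (coords (single j)) = ((j : ℝ) + 1) ^ m := by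
  unfold wnorm
  rw [tsum_eq_single j]
  · have hj : (0 : ℝ) < (j : ℝ) + 1 := by positivity
    have : ((j : ℝ) + 1) ^ (2 * m) = (((j : ℝ) + 1) ^ m) ^ 2 := by
      rw [two_mul, zpow_add₀ hj.ne', sq]
    simp only [single, coords_mk, Pi.single_eq_same, norm_one, one_pow, one_mul, this]
    exact Real.sqrt_sq (by positivity)
  · intro k hk
    simp [single, Pi.single_eq_of_ne hk]

/-- Every `ξ ∈ s'` is the sum of `∑ ξ_j e_j`. -/
theorem hasSum_single (ξ : SlowSeq) : HasSum (fun j => ξ j • single j) ξ := by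
  obtain ⟨q, hq⟩ := ξ.summable
  unfold HasSum
  rw [withSeminorms.tendsto_nhds]
  intro p ε hε
  obtain ⟨C, hC0, hC⟩ := seminorms_bound p q
  have hcoe : ∀ (F : Finset ℕ) (k : ℕ),
      coords ((∑ j ∈ F, ξ j • single j : SlowSeq) - ξ) k = if k ∈ F then 0 else - ξ k := by
    intro F k
    rw [map_sub, map_sum, Pi.sub_apply, Finset.sum_apply]
    have h3 : ∀ j ∈ F, coords (ξ j • single j) k = if k = j then ξ j else 0 := by
      intro j _
      simp [single, Pi.single_apply]
    rw [Finset.sum_congr rfl h3, Finset.sum_ite_eq]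
    split_ifs <;> simp
  have htail := tendsto_tsum_compl_atTop_zero
    (fun j : ℕ => ‖ξ j‖ ^ 2 * ((j : ℝ) + 1) ^ (2 * (-(q : ℤ))))
  have hδ : 0 < (ε / C) ^ 2 := by positivity
  filter_upwards [htail.eventually_lt_const hδ] with F hF
  have hsum : WSummable (-(q : ℤ)) (coords ((∑ j ∈ F, ξ j • single j : SlowSeq) - ξ)) := by
    refine Summable.of_nonneg_of_le (fun j => by positivity) (fun k => ?_) hq
    rw [hcoe]
    split_ifs
    · simp; positivity
    · simp
  have hn : wnorm (-(q : ℤ)) (coords ((∑ j ∈ F, ξ j • single j : SlowSeq) - ξ)) < ε / C := by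
    unfold wnorm
    rw [Real.sqrt_lt' (by positivity)]
    refine lt_of_eq_of_lt ?_ hF
    refine Eq.trans ?_ (tsum_subtype {a | a ∉ F}
      (fun j : ℕ => ‖ξ j‖ ^ 2 * ((j : ℝ) + 1) ^ (2 * (-(q : ℤ))))).symm
    refine tsum_congr fun k => ?_
    rw [hcoe]
    by_cases hk : k ∈ F <;> simp [hk]
  calc seminorms p ((∑ j ∈ F, ξ j • single j) - ξ)
      ≤ C * wnorm (-(q : ℤ)) (coords ((∑ j ∈ F, ξ j • single j : SlowSeq) - ξ)) := hC _ hsum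
    _ < C * (ε / C) := by gcongr
    _ = ε := by field_simp

/-- A continuous seminorm on `s'` is bounded by a multiple of `|·|'_q` on each step. -/
theorem bound_of_continuous (p : Seminorm ℂ SlowSeq) (hp : Continuous p) (q : ℕ) :
    ∃ C : ℝ, 0 ≤ C ∧ ∀ ξ : SlowSeq, WSummable (-(q : ℤ)) (coords ξ) →
      p ξ ≤ C * wnorm (-(q : ℤ)) (coords ξ) := by
  obtain ⟨F, C, -, hC⟩ := Seminorm.bound_of_continuous withSeminorms p hp
  choose D hD0 hD using fun i : StepContinuous => seminorms_bound i q
  refine ⟨C * ∑ i ∈ F, D i, mul_nonneg C.2 (Finset.sum_nonneg fun i _ => (hD0 i).le),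
    fun ξ hξ => ?_⟩
  have h1 : (F.sup seminorms) ξ ≤ (∑ i ∈ F, D i) * wnorm (-(q : ℤ)) (coords ξ) := by
    refine Seminorm.finset_sup_apply_le
      (mul_nonneg (Finset.sum_nonneg fun i _ => (hD0 i).le) (wnorm_nonneg _ _)) fun i hi => ?_
    refine (hD i ξ hξ).trans (mul_le_mul_of_nonneg_right ?_ (wnorm_nonneg _ _))
    exact Finset.single_le_sum (fun i _ => (hD0 i).le) hi
  calc p ξ ≤ (C • F.sup seminorms) ξ := hC ξ
    _ = C * (F.sup seminorms) ξ := rfl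
    _ ≤ C * ((∑ i ∈ F, D i) * wnorm (-(q : ℤ)) (coords ξ)) := by gcongr
    _ = _ := by ring

end SlowSeq

/-- The canonical inclusion `s ↪ s'` as a linear map. -/
def rapidToSlowLin : RapidSeq →ₗ[ℂ] SlowSeq where
  toFun ξ := SlowSeq.mk ξ.coords ⟨0, by simpa using ξ.summable 0⟩
  map_add' _ _ := rfl
  map_smul' _ _ := rfl

/-- The canonical continuous inclusion `j : s ↪ s'`. -/
def rapidToSlow : RapidSeq →L[ℂ] SlowSeq where
  toLinearMap := rapidToSlowLin
  cont := by
    refine WithSeminorms.continuous_of_isBounded RapidSeq.withSeminorms SlowSeq.withSeminorms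
      rapidToSlowLin (fun p => ?_)
    obtain ⟨C, hC0, hC⟩ := SlowSeq.seminorms_bound p 0
    refine ⟨{0}, ⟨C, hC0.le⟩, fun ξ => ?_⟩
    refine (hC (rapidToSlowLin ξ) (ξ.summable 0)).trans ?_
    simp only [Finset.sup_singleton]
    change C * _ ≤ C * wnorm _ ξ.coords
    simp only [CharP.cast_eq_zero, neg_zero]
    exact le_rfl

@[simp] theorem coords_rapidToSlow (ξ : RapidSeq) : (rapidToSlow ξ).coords = ξ.coords := rfl

/-- `⟨ξ, η⟩ = ∑ ξ_j conj η_j` for `ξ ∈ s`, `η ∈ s'`. -/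
def pairing (ξ : RapidSeq) (η : SlowSeq) : ℂ := ∑' j, ξ j * star (η j)

theorem pairing_le {q : ℕ} (ξ : RapidSeq) {η : SlowSeq}
    (h : WSummable (-(q : ℤ)) η.coords) :
    Summable (fun j => ξ j * star (η j)) ∧
      ‖pairing ξ η‖ ≤ wnorm q ξ.coords * wnorm (-(q : ℤ)) η.coords :=
  pairing_bound (ξ.summable q) h

/-- The functional `ξ ↦ ⟨ξ, η⟩` on `s` given by `η ∈ s'`. -/
def pairingLin (η : SlowSeq) : RapidSeq →ₗ[ℂ] ℂ where
  toFun ξ := pairing ξ η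
  map_add' ξ ξ' := by
    obtain ⟨q, hq⟩ := η.summable
    unfold pairing
    rw [← (pairing_le ξ hq).1.tsum_add (pairing_le ξ' hq).1]
    simp [add_mul]
  map_smul' c ξ := by
    unfold pairing
    simp [mul_assoc, tsum_mul_left]

/-- The functional `ξ ↦ ⟨ξ, η⟩` is continuous on `s`. -/
def pairingCLM (η : SlowSeq) : RapidSeq →L[ℂ] ℂ where
  toLinearMap := pairingLin η
  cont := by
    refine WithSeminorms.continuous_normedSpace_rng ℂ RapidSeq.withSeminorms
      (pairingLin η) ?_
    obtain ⟨q, hq⟩ := η.summable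
    refine ⟨{q}, ⟨wnorm (-(q : ℤ)) η.coords, wnorm_nonneg _ _⟩, fun ξ => ?_⟩
    refine ((pairing_le ξ hq).2).trans (le_of_eq ?_)
    simp only [Finset.sup_singleton]
    exact mul_comm _ _

theorem pairingCLM_apply (η : SlowSeq) (ξ : RapidSeq) : pairingCLM η ξ = pairing ξ η := rfl

theorem pairing_single (ξ : RapidSeq) (j : ℕ) : pairing ξ (SlowSeq.single j) = ξ j := by
  unfold pairing
  rw [tsum_eq_single j]
  · simp [SlowSeq.single]
  · intro k hk; simp [SlowSeq.single, Pi.single_eq_of_ne hk]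

/-! ### The algebra `L(s', s)` of smooth operators -/

/-- The space `L(s', s)` of continuous linear operators from `s'` to `s`. -/
def SmoothOp : Type := SlowSeq →L[ℂ] RapidSeq

namespace SmoothOp

instance : AddCommGroup SmoothOp := inferInstanceAs (AddCommGroup (SlowSeq →L[ℂ] RapidSeq))
instance : Module ℂ SmoothOp := inferInstanceAs (Module ℂ (SlowSeq →L[ℂ] RapidSeq))
instance : FunLike SmoothOp SlowSeq RapidSeq :=
  inferInstanceAs (FunLike (SlowSeq →L[ℂ] RapidSeq) SlowSeq RapidSeq)
instance : ContinuousLinearMapClass SmoothOp ℂ SlowSeq RapidSeq :=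
  inferInstanceAs (ContinuousLinearMapClass (SlowSeq →L[ℂ] RapidSeq) ℂ SlowSeq RapidSeq)

@[simp] theorem add_apply (x y : SmoothOp) (ξ : SlowSeq) : (x + y) ξ = x ξ + y ξ := rfl
@[simp] theorem smul_apply (c : ℂ) (x : SmoothOp) (ξ : SlowSeq) : (c • x) ξ = c • x ξ := rfl
@[simp] theorem zero_apply (ξ : SlowSeq) : (0 : SmoothOp) ξ = 0 := rfl
@[simp] theorem sub_apply (x y : SmoothOp) (ξ : SlowSeq) : (x - y) ξ = x ξ - y ξ := rfl

theorem ext {x y : SmoothOp} (h : ∀ ξ, x ξ = y ξ) : x = y := DFunLike.ext _ _ h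

/-- A linear map `s' → s` that is bounded from each step of `s'` is continuous. -/
def ofBound (f : SlowSeq →ₗ[ℂ] RapidSeq)
    (h : ∀ q k : ℕ, ∃ C : ℝ, ∀ ξ : SlowSeq, WSummable (-(k : ℤ)) ξ.coords →
      wnorm q (f ξ).coords ≤ C * wnorm (-(k : ℤ)) ξ.coords) : SmoothOp :=
  ContinuousLinearMap.mk f <| by
    refine WithSeminorms.continuous_of_isBounded SlowSeq.withSeminorms RapidSeq.withSeminorms f
      (fun q => ?_)
    let i : SlowSeq.StepContinuous := ⟨(RapidSeq.norm q).comp f, fun k => h q k⟩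
    refine ⟨{i}, 1, ?_⟩
    rw [Finset.sup_singleton, one_smul]
    exact fun _ => le_rfl

theorem ofBound_apply (f : SlowSeq →ₗ[ℂ] RapidSeq) (h) (ξ : SlowSeq) :
    ofBound f h ξ = f ξ := rfl

/-- The values `|xξ|_q` for `|ξ|'_q ≤ 1`. -/
def unitBallValues (q : ℕ) (x : SmoothOp) : Set ℝ :=
  {r | ∃ ξ : SlowSeq, WSummable (-(q : ℤ)) ξ.coords ∧ wnorm (-(q : ℤ)) ξ.coords ≤ 1 ∧
    r = wnorm q (x ξ).coords}

/-- `‖x‖_q = sup {|xξ|_q : |ξ|'_q ≤ 1}`. -/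
def opNorm (q : ℕ) (x : SmoothOp) : ℝ := sSup (unitBallValues q x)

theorem exists_bound (x : SmoothOp) (q k : ℕ) :
    ∃ C : ℝ, 0 ≤ C ∧ ∀ ξ : SlowSeq, WSummable (-(k : ℤ)) ξ.coords →
      wnorm q (x ξ).coords ≤ C * wnorm (-(k : ℤ)) ξ.coords :=
  SlowSeq.bound_of_continuous ((RapidSeq.norm q).comp (x : SlowSeq →L[ℂ] RapidSeq).toLinearMap)
    ((RapidSeq.withSeminorms.continuous_seminorm q).comp (map_continuous x)) k

theorem bddAbove_unitBallValues (q : ℕ) (x : SmoothOp) : BddAbove (unitBallValues q x) := by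
  obtain ⟨C, hC0, hC⟩ := exists_bound x q q
  refine ⟨C, ?_⟩
  rintro r ⟨ξ, h1, h2, rfl⟩
  exact (hC ξ h1).trans (mul_le_of_le_one_right hC0 h2)

theorem unitBallValues_nonempty (q : ℕ) (x : SmoothOp) : (unitBallValues q x).Nonempty :=
  ⟨_, 0, by rw [map_zero]; exact WSummable.zero _, by rw [map_zero, wnorm_zero]; simp, rfl⟩

theorem opNorm_nonneg (q : ℕ) (x : SmoothOp) : 0 ≤ opNorm q x := by
  refine Real.sSup_nonneg ?_
  rintro r ⟨ξ, -, -, rfl⟩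
  exact wnorm_nonneg _ _

theorem opNorm_le (q : ℕ) (x : SmoothOp) {C : ℝ} (h : ∀ ξ : SlowSeq,
    WSummable (-(q : ℤ)) ξ.coords → wnorm (-(q : ℤ)) ξ.coords ≤ 1 → wnorm q (x ξ).coords ≤ C) :
    opNorm q x ≤ C := by
  refine csSup_le (unitBallValues_nonempty q x) ?_
  rintro r ⟨ξ, h1, h2, rfl⟩
  exact h ξ h1 h2

theorem le_opNorm_of_unit (q : ℕ) (x : SmoothOp) {ξ : SlowSeq}
    (h1 : WSummable (-(q : ℤ)) ξ.coords) (h2 : wnorm (-(q : ℤ)) ξ.coords ≤ 1) :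
    wnorm q (x ξ).coords ≤ opNorm q x :=
  le_csSup (bddAbove_unitBallValues q x) ⟨ξ, h1, h2, rfl⟩

theorem le_opNorm (q : ℕ) (x : SmoothOp) {ξ : SlowSeq} (h : WSummable (-(q : ℤ)) ξ.coords) :
    wnorm q (x ξ).coords ≤ opNorm q x * wnorm (-(q : ℤ)) ξ.coords := by
  rcases (wnorm_nonneg (-(q : ℤ)) ξ.coords).eq_or_lt with h0 | h0
  · obtain ⟨C, -, hC⟩ := exists_bound x q q
    have := hC ξ h
    rw [← h0] at this ⊢
    simpa using this
  · set t := wnorm (-(q : ℤ)) ξ.coords with ht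
    have h1 := le_opNorm_of_unit q x (ξ := ((t⁻¹ : ℝ) : ℂ) • ξ)
      (by rw [map_smul]; exact h.smul _)
      (by
        rw [map_smul, wnorm_smul, Complex.norm_real, ← ht, Real.norm_of_nonneg (by positivity)]
        exact (inv_mul_cancel₀ h0.ne').le)
    rw [map_smul, map_smul, wnorm_smul, Complex.norm_real,
      Real.norm_of_nonneg (by positivity)] at h1
    calc wnorm q (x ξ).coords = (t⁻¹ * wnorm q (x ξ).coords) * t := by field_simp
      _ ≤ opNorm q x * t := by gcongr

/-- The norm `‖·‖_q` on `L(s', s)` as a seminorm. -/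
def norm (q : ℕ) : Seminorm ℂ SmoothOp :=
  Seminorm.ofSMulLE (opNorm q)
    (le_antisymm (opNorm_le q 0 fun ξ _ _ => by
      rw [zero_apply, map_zero, wnorm_zero]) (opNorm_nonneg q 0))
    (fun x y => opNorm_le q _ fun ξ h1 h2 => by
      rw [add_apply, map_add]
      exact (wnorm_add_le ((x ξ).summable q) ((y ξ).summable q)).trans
        (add_le_add (le_opNorm_of_unit q x h1 h2) (le_opNorm_of_unit q y h1 h2)))
    (fun c x => opNorm_le q _ fun ξ h1 h2 => by
      rw [smul_apply, map_smul, wnorm_smul]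
      exact mul_le_mul_of_nonneg_left (le_opNorm_of_unit q x h1 h2) (norm_nonneg _))

theorem norm_apply (q : ℕ) (x : SmoothOp) : norm q x = opNorm q x := rfl

/-- The topology of `L(s', s)` is given by the norms `‖·‖_q`. -/
instance : TopologicalSpace SmoothOp :=
  (SeminormFamily.moduleFilterBasis (norm : SeminormFamily ℂ SmoothOp ℕ)).topology

theorem withSeminorms : WithSeminorms (norm : SeminormFamily ℂ SmoothOp ℕ) := ⟨rfl⟩

instance : IsTopologicalAddGroup SmoothOp := withSeminorms.topologicalAddGroup
instance : ContinuousSMul ℂ SmoothOp := withSeminorms.continuousSMul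

theorem eq_zero_of_wnorm {m : ℤ} {ξ : ℕ → ℂ} (h : WSummable m ξ) (h0 : wnorm m ξ = 0) :
    ξ = 0 := by
  rw [← norm_wl2 h, norm_eq_zero] at h0
  funext j
  have h1 : wseq m ξ j = 0 := congrFun (congrArg Subtype.val h0) j
  have hj : (0 : ℝ) < (j : ℝ) + 1 := by positivity
  unfold wseq at h1
  rcases mul_eq_zero.1 h1 with h2 | h2
  · exact absurd (Complex.ofReal_eq_zero.1 h2) (zpow_ne_zero _ hj.ne')
  · simpa using h2

instance : T2Space SmoothOp := by
  have : T1Space SmoothOp := withSeminorms.T1_of_separating fun x hx => by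
    by_contra hcon
    push Not at hcon
    refine hx (ext fun ξ => ?_)
    obtain ⟨q, hq⟩ := ξ.summable
    have h1 := le_opNorm q x hq
    rw [← norm_apply, hcon q, zero_mul] at h1
    refine RapidSeq.ext ?_
    rw [zero_apply, map_zero]
    exact eq_zero_of_wnorm ((x ξ).summable q) (le_antisymm h1 (wnorm_nonneg _ _))
  infer_instance

/-- The product `x · y = x ∘ j ∘ y`. -/
instance : Mul SmoothOp where
  mul x y := ContinuousLinearMap.comp (show SlowSeq →L[ℂ] RapidSeq from x)
    (rapidToSlow.comp (show SlowSeq →L[ℂ] RapidSeq from y))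

@[simp] theorem mul_apply (x y : SmoothOp) (ξ : SlowSeq) : (x * y) ξ = x (rapidToSlow (y ξ)) := rfl

instance : NonUnitalRing SmoothOp :=
  { (inferInstance : AddCommGroup SmoothOp), (inferInstance : Mul SmoothOp) with
    left_distrib := fun x y z => ext fun ξ => by simp
    right_distrib := fun x y z => ext fun ξ => by simp
    zero_mul := fun x => ext fun ξ => by simp
    mul_zero := fun x => ext fun ξ => by simp
    mul_assoc := fun x y z => ext fun ξ => by simp }

instance : IsScalarTower ℂ SmoothOp SmoothOp := ⟨fun c x y => ext fun ξ => by simp⟩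
instance : SMulCommClass ℂ SmoothOp SmoothOp := ⟨fun c x y => ext fun ξ => by simp⟩

theorem opNorm_mul_le (q : ℕ) (x y : SmoothOp) : opNorm q (x * y) ≤ opNorm q x * opNorm q y := by
  refine opNorm_le q _ fun ξ h1 h2 => ?_
  have hy := (y ξ).summable q
  have hneg : -(q : ℤ) ≤ q := by omega
  calc wnorm q ((x * y) ξ).coords ≤ opNorm q x * wnorm (-(q : ℤ)) (y ξ).coords :=
        le_opNorm q x (ξ := rapidToSlow (y ξ)) (hy.mono hneg)
    _ ≤ opNorm q x * opNorm q y :=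
        mul_le_mul_of_nonneg_left
          ((wnorm_mono hneg hy).trans (le_opNorm_of_unit q y h1 h2)) (opNorm_nonneg q x)

instance : ContinuousMul SmoothOp where
  continuous_mul := by
    rw [continuous_iff_continuousAt]
    rintro ⟨x₀, y₀⟩
    unfold ContinuousAt
    rw [withSeminorms.tendsto_nhds]
    intro q ε hε
    have hx : Continuous fun z : SmoothOp × SmoothOp => norm q (z.1 - x₀) :=
      (withSeminorms.continuous_seminorm q).comp (continuous_fst.sub continuous_const)
    have hy : Continuous fun z : SmoothOp × SmoothOp => norm q (z.2 - y₀) :=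
      (withSeminorms.continuous_seminorm q).comp (continuous_snd.sub continuous_const)
    have hb : Continuous fun z : SmoothOp × SmoothOp =>
        norm q (z.1 - x₀) * norm q (z.2 - y₀) + norm q x₀ * norm q (z.2 - y₀)
          + norm q (z.1 - x₀) * norm q y₀ := by fun_prop
    have h0 := hb.tendsto (x₀, y₀)
    simp only [sub_self, map_zero, mul_zero, zero_mul, add_zero] at h0
    filter_upwards [h0.eventually_lt_const hε] with z hz
    refine lt_of_le_of_lt ?_ hz
    have he : z.1 * z.2 - x₀ * y₀ = (z.1 - x₀) * (z.2 - y₀) + x₀ * (z.2 - y₀)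
        + (z.1 - x₀) * y₀ := by
      simp only [sub_mul, mul_sub]; abel
    simp only [he]
    refine (map_add_le_add _ _ _).trans (add_le_add ((map_add_le_add _ _ _).trans
      (add_le_add ?_ ?_)) ?_) <;> exact opNorm_mul_le q _ _

instance : IsTopologicalRing SmoothOp where

/-! The Hilbertian involution: `(x* η)_j = conj ⟨x e_j, η⟩ = ⟨η, x e_j⟩`. -/

theorem star_coord_le (x : SmoothOp) (q k : ℕ) {η : SlowSeq}
    (h : WSummable (-(k : ℤ)) η.coords) (j : ℕ) :
    ‖star (pairing (x (SlowSeq.single j)) η)‖ ≤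
      opNorm (max k (q + 1)) x * wnorm (-(k : ℤ)) η.coords * ((j : ℝ) + 1) ^ (-((q : ℤ) + 1)) := by
  set r := max k (q + 1) with hr
  have hkr : k ≤ r := le_max_left _ _
  have hqr : q + 1 ≤ r := le_max_right _ _
  have h' : WSummable (-(r : ℤ)) η.coords := h.mono (by omega)
  rw [norm_star]
  have h1 := (pairing_le (x (SlowSeq.single j)) h').2
  have h2 := le_opNorm r x (SlowSeq.single_wSummable (-(r : ℤ)) j)
  rw [SlowSeq.single_wnorm] at h2
  have h3 : ((j : ℝ) + 1) ^ (-(r : ℤ)) ≤ ((j : ℝ) + 1) ^ (-((q : ℤ) + 1)) :=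
    zpow_le_zpow_right₀ (by linarith [(Nat.cast_nonneg j : (0 : ℝ) ≤ j)]) (by omega)
  have h4 : wnorm (-(r : ℤ)) η.coords ≤ wnorm (-(k : ℤ)) η.coords := wnorm_mono (by omega) h
  calc _ ≤ wnorm r (x (SlowSeq.single j)).coords * wnorm (-(r : ℤ)) η.coords := h1
    _ ≤ (opNorm r x * ((j : ℝ) + 1) ^ (-((q : ℤ) + 1))) * wnorm (-(k : ℤ)) η.coords :=
        mul_le_mul (h2.trans (mul_le_mul_of_nonneg_left h3 (opNorm_nonneg _ _))) h4
          (wnorm_nonneg _ _) (mul_nonneg (opNorm_nonneg _ _) (by positivity))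
    _ = _ := by ring

theorem star_bound (x : SmoothOp) (q k : ℕ) {η : SlowSeq}
    (h : WSummable (-(k : ℤ)) η.coords) :
    WSummable q (fun j => star (pairing (x (SlowSeq.single j)) η)) ∧
    wnorm q (fun j => star (pairing (x (SlowSeq.single j)) η)) ≤
      Real.sqrt (∑' j : ℕ, ((j : ℝ) + 1) ^ (-2 : ℤ)) *
        (opNorm (max k (q + 1)) x * wnorm (-(k : ℤ)) η.coords) :=
  wnorm_le_of_coord (mul_nonneg (opNorm_nonneg _ _) (wnorm_nonneg _ _)) (star_coord_le x q k h)

theorem pairing_add_right (ξ : RapidSeq) (η η' : SlowSeq) :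
    pairing ξ (η + η') = pairing ξ η + pairing ξ η' := by
  obtain ⟨q, hq⟩ := η.summable
  obtain ⟨q', hq'⟩ := η'.summable
  unfold pairing
  rw [← (pairing_le ξ hq).1.tsum_add (pairing_le ξ hq').1]
  simp [mul_add]

theorem pairing_smul_right (ξ : RapidSeq) (c : ℂ) (η : SlowSeq) :
    pairing ξ (c • η) = star c * pairing ξ η := by
  unfold pairing
  rw [← tsum_mul_left]
  refine tsum_congr fun j => ?_
  simp; ring

/-- The Hilbertian adjoint as a linear map. -/
def adjointLin (x : SmoothOp) : SlowSeq →ₗ[ℂ] RapidSeq where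
  toFun η := RapidSeq.mk (fun j => star (pairing (x (SlowSeq.single j)) η)) fun q => by
    obtain ⟨k, hk⟩ := η.summable
    exact (star_bound x q k hk).1
  map_add' η η' := RapidSeq.ext <| by
    funext j; simp [pairing_add_right]
  map_smul' c η := RapidSeq.ext <| by
    funext j; simp [pairing_smul_right]

/-- The Hilbertian involution `x ↦ x*` on `L(s', s)`, with matrix
`⟨x* e_k, e_j⟩ = conj ⟨x e_j, e_k⟩`. -/
instance : Star SmoothOp where
  star x := ofBound (adjointLin x) fun q k =>
    ⟨Real.sqrt (∑' j : ℕ, ((j : ℝ) + 1) ^ (-2 : ℤ)) * opNorm (max k (q + 1)) x, fun ξ h => by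
      rw [mul_assoc]; exact (star_bound x q k h).2⟩

theorem star_apply_coord (x : SmoothOp) (η : SlowSeq) (j : ℕ) :
    (star x η) j = star (pairing (x (SlowSeq.single j)) η) := rfl

theorem hasSum_apply (x : SmoothOp) (ξ : SlowSeq) (L : RapidSeq →L[ℂ] ℂ) :
    HasSum (fun j => ξ j * L (x (SlowSeq.single j))) (L (x ξ)) := by
  have h := (SlowSeq.hasSum_single ξ).mapL
    (L.comp (show SlowSeq →L[ℂ] RapidSeq from x))
  refine h.congr_fun ?_
  intro j
  exact (map_smul (L.comp (show SlowSeq →L[ℂ] RapidSeq from x)) (ξ j) (SlowSeq.single j)).symm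

/-- `star x` is the adjoint of `x`: `⟨xξ, η⟩ = ⟨ξ, x*η⟩`. -/
theorem pairing_star (x : SmoothOp) (ξ η : SlowSeq) :
    pairing (x ξ) η = star (pairing (star x η) ξ) := by
  rw [← pairingCLM_apply, ← (hasSum_apply x ξ (pairingCLM η)).tsum_eq]
  unfold pairing
  rw [tsum_star]
  refine tsum_congr fun j => ?_
  rw [star_mul', star_star, star_apply_coord, star_star, pairingCLM_apply, mul_comm]

theorem pairing_symm (ξ η : RapidSeq) :
    pairing ξ (rapidToSlow η) = star (pairing η (rapidToSlow ξ)) := by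
  unfold pairing
  rw [tsum_star]
  refine tsum_congr fun j => ?_
  simp [mul_comm]

instance : StarRing SmoothOp where
  star_involutive x := ext fun η => RapidSeq.ext <| by
    funext j
    rw [star_apply_coord, ← pairing_star, pairing_single]
  star_mul x y := ext fun η => RapidSeq.ext <| by
    funext j
    rw [star_apply_coord, mul_apply, mul_apply, pairing_star, star_star, star_apply_coord,
      pairing_symm]
  star_add x y := ext fun η => RapidSeq.ext <| by
    funext j
    rw [add_apply, map_add, Pi.add_apply]
    simp only [star_apply_coord, add_apply, ← pairingCLM_apply, map_add, star_add]

instance : StarModule ℂ SmoothOp where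
  star_smul c x := ext fun η => RapidSeq.ext <| by
    funext j
    rw [smul_apply, map_smul, Pi.smul_apply]
    simp only [star_apply_coord, smul_apply, ← pairingCLM_apply, map_smul, star_smul]

theorem opNorm_star_le (q : ℕ) (x : SmoothOp) :
    opNorm q (star x) ≤ Real.sqrt (∑' j : ℕ, ((j : ℝ) + 1) ^ (-2 : ℤ)) * opNorm (q + 1) x := by
  refine opNorm_le q _ fun ξ h1 h2 => ?_
  have h := (star_bound x q q h1).2
  rw [max_eq_right (Nat.le_succ q)] at h
  refine h.trans (mul_le_mul_of_nonneg_left ?_ (Real.sqrt_nonneg _))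
  exact mul_le_of_le_one_right (opNorm_nonneg _ _) h2

instance : ContinuousStar SmoothOp where
  continuous_star := by
    rw [continuous_iff_continuousAt]
    intro x₀
    unfold ContinuousAt
    rw [withSeminorms.tendsto_nhds]
    intro q ε hε
    have hb : Continuous fun x : SmoothOp =>
        Real.sqrt (∑' j : ℕ, ((j : ℝ) + 1) ^ (-2 : ℤ)) * norm (q + 1) (x - x₀) :=
      continuous_const.mul ((withSeminorms.continuous_seminorm (q + 1)).comp
        (continuous_id.sub continuous_const))
    have h0 := hb.tendsto x₀
    simp only [sub_self, map_zero, mul_zero] at h0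
    filter_upwards [h0.eventually_lt_const hε] with x hx
    refine lt_of_le_of_lt ?_ hx
    rw [← star_sub]
    exact opNorm_star_le q _

end SmoothOp

/-- A complex Fréchet algebra: a complete metrizable locally convex space with a continuous
(bilinear, associative) multiplication. -/
structure IsFrechetAlgebra (A : Type*) [NonUnitalRing A] [Module ℂ A] [IsScalarTower ℂ A A]
    [SMulCommClass ℂ A A] [TopologicalSpace A] : Prop where
  topologicalAddGroup : IsTopologicalAddGroup A
  continuousSMul : ContinuousSMul ℂ A
  locallyConvex : LocallyConvexSpace ℝ A
  metrizable : TopologicalSpace.MetrizableSpace A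
  complete : @CompleteSpace A (IsTopologicalAddGroup.rightUniformSpace A)
  continuousMul : ContinuousMul A

/-- The closed `*`-subalgebra `alg(x)` of `L(s', s)` generated by `x`. -/
abbrev SmoothOp.alg (x : SmoothOp) : NonUnitalStarSubalgebra ℂ SmoothOp :=
  NonUnitalStarAlgebra.elemental ℂ x

/-- `x` is infinite dimensional: its range is not finite dimensional. -/
def SmoothOp.IsInfiniteDimensional (x : SmoothOp) : Prop :=
  ¬ FiniteDimensional ℂ (LinearMap.range (x : SlowSeq →ₗ[ℂ] RapidSeq))

/-- `x = ∑ λ_n P_n` is a spectral representation of `x`: the `λ_n` are nonzero, pairwise different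
and ordered by decreasing modulus, the `P_n` are nonzero pairwise orthogonal finite dimensional
(self-adjoint) projections in `L(s', s)`, and the series converges to `x` in `L(s', s)`. -/
structure IsSpectralRepresentation (x : SmoothOp) (lam : ℕ → ℂ) (P : ℕ → SmoothOp) : Prop where
  lam_ne_zero : ∀ n, lam n ≠ 0
  lam_injective : Function.Injective lam
  lam_antitone : Antitone fun n => ‖lam n‖
  isStarProjection : ∀ n, IsStarProjection (P n)
  proj_ne_zero : ∀ n, P n ≠ 0
  orthogonal : ∀ m n, m ≠ n → P m * P n = 0
  finiteDimensional : ∀ n, ¬ (P n).IsInfiniteDimensional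
  tendsto : Tendsto (fun N => ∑ n ∈ Finset.range N, lam n • P n) atTop (𝓝 x)

namespace IsSpectralRepresentation

variable {x : SmoothOp} {lam : ℕ → ℂ} {P : ℕ → SmoothOp}

theorem mul_proj (h : IsSpectralRepresentation x lam P) (n : ℕ) : x * P n = lam n • P n := by
  have h1 : Tendsto (fun N => (∑ k ∈ Finset.range N, lam k • P k) * P n) atTop (𝓝 (x * P n)) :=
    h.tendsto.mul_const (P n)
  refine tendsto_nhds_unique h1 (tendsto_const_nhds.congr' ?_)
  filter_upwards [eventually_gt_atTop n] with N hN
  rw [Finset.sum_mul, Finset.sum_eq_single_of_mem n (Finset.mem_range.2 hN)]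
  · rw [smul_mul_assoc, (h.isStarProjection n).isIdempotentElem.eq]
  · intro k _ hk
    rw [smul_mul_assoc, h.orthogonal k n hk, smul_zero]

theorem mem_quasispectrum (h : IsSpectralRepresentation x lam P) (n : ℕ) :
    lam n ∈ quasispectrum ℂ x := by
  refine quasispectrum.mem_of_not_quasiregular x (r := Units.mk0 (lam n) (h.lam_ne_zero n)) ?_
  rw [isQuasiregular_iff]
  rintro ⟨y, -, hy⟩
  have hu : (-((Units.mk0 (lam n) (h.lam_ne_zero n))⁻¹ • x)) * P n = - P n := by
    rw [neg_mul, smul_mul_assoc, h.mul_proj n, Units.smul_def, smul_smul]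
    simp [h.lam_ne_zero n]
  have h2 := congrArg (· * P n) hy
  simp only [add_mul, mul_assoc y, hu, zero_mul] at h2
  rw [mul_neg] at h2
  refine h.proj_ne_zero n ?_
  have : -P n = 0 := by rw [← h2]; abel
  simpa using this

theorem one_le_opNorm (h : IsSpectralRepresentation x lam P) (n q : ℕ) :
    1 ≤ SmoothOp.opNorm q (P n) := by
  have hex : ∃ ξ, P n ξ ≠ 0 := by
    by_contra hcon
    push Not at hcon
    exact h.proj_ne_zero n (SmoothOp.ext hcon)
  obtain ⟨ξ, hξ⟩ := hex
  set η := P n ξ with hη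
  have hfix : P n (rapidToSlow η) = η := by
    rw [hη, ← SmoothOp.mul_apply, (h.isStarProjection n).isIdempotentElem.eq]
  have hneg : -(q : ℤ) ≤ q := by omega
  have h1 := SmoothOp.le_opNorm q (P n) (ξ := rapidToSlow η) ((η.summable q).mono hneg)
  rw [hfix, coords_rapidToSlow] at h1
  have h2 : wnorm (-(q : ℤ)) η.coords ≤ wnorm q η.coords := wnorm_mono hneg (η.summable q)
  have h3 : 0 < wnorm q η.coords := by
    refine lt_of_le_of_ne (wnorm_nonneg _ _) fun h0 => hξ (RapidSeq.ext ?_)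
    rw [map_zero]
    exact SmoothOp.eq_zero_of_wnorm (η.summable q) h0.symm
  have h4 := h1.trans (mul_le_mul_of_nonneg_left h2 (SmoothOp.opNorm_nonneg q (P n)))
  nlinarith

/-- `λ_n` as a point of the spectrum `σ(x)`. -/
def point (h : IsSpectralRepresentation x lam P) (n : ℕ) : quasispectrum ℂ x :=
  ⟨lam n, h.mem_quasispectrum n⟩

/-- The functions `f : σ(x) → ℂ` with `f(0) = 0` and `(f(λ_n)) ∈ λ^∞(‖P_n‖_q)`, as an algebra under
pointwise operations. The spectrum `σ(x)` of `x` in the non-unital algebra `L(s', s)` is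
`quasispectrum ℂ x`, i.e. the spectrum of `x` in the unitization of `L(s', s)`. -/
def functionAlgebra (h : IsSpectralRepresentation x lam P) :
    NonUnitalStarSubalgebra ℂ (quasispectrum ℂ x → ℂ) where
  carrier := {f | f 0 = 0 ∧
    ∀ q : ℕ, BddAbove (Set.range fun n => ‖f (h.point n)‖ * SmoothOp.opNorm q (P n))}
  zero_mem' := ⟨rfl, fun q => ⟨0, by rintro _ ⟨n, rfl⟩; simp⟩⟩
  add_mem' := by
    rintro f g ⟨hf0, hf⟩ ⟨hg0, hg⟩
    refine ⟨by simp [hf0, hg0], fun q => ?_⟩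
    obtain ⟨C, hC⟩ := hf q
    obtain ⟨D, hD⟩ := hg q
    refine ⟨C + D, ?_⟩
    rintro _ ⟨n, rfl⟩
    refine le_trans ?_ (add_le_add (hC ⟨n, rfl⟩) (hD ⟨n, rfl⟩))
    simp only [Pi.add_apply, ← add_mul]
    exact mul_le_mul_of_nonneg_right (norm_add_le _ _) (SmoothOp.opNorm_nonneg _ _)
  smul_mem' := by
    rintro c f ⟨hf0, hf⟩
    refine ⟨by simp [hf0], fun q => ?_⟩
    obtain ⟨C, hC⟩ := hf q
    refine ⟨‖c‖ * C, ?_⟩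
    rintro _ ⟨n, rfl⟩
    simp only [Pi.smul_apply, norm_smul, mul_assoc]
    exact mul_le_mul_of_nonneg_left (hC ⟨n, rfl⟩) (norm_nonneg _)
  mul_mem' := by
    rintro f g ⟨hf0, hf⟩ ⟨hg0, hg⟩
    refine ⟨by simp [hf0], fun q => ?_⟩
    obtain ⟨C, hC⟩ := hf q
    obtain ⟨D, hD⟩ := hg q
    refine ⟨C * D, ?_⟩
    rintro _ ⟨n, rfl⟩
    have hN := h.one_le_opNorm n q
    have h1 := hC ⟨n, rfl⟩
    have h2 := hD ⟨n, rfl⟩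
    simp only [Pi.mul_apply, norm_mul] at h1 h2 ⊢
    have h3 : ‖g (h.point n)‖ ≤ ‖g (h.point n)‖ * SmoothOp.opNorm q (P n) :=
      le_mul_of_one_le_right (norm_nonneg _) hN
    have h0 : 0 ≤ ‖f (h.point n)‖ * SmoothOp.opNorm q (P n) := by positivity
    calc ‖f (h.point n)‖ * ‖g (h.point n)‖ * SmoothOp.opNorm q (P n)
        = (‖f (h.point n)‖ * SmoothOp.opNorm q (P n)) * ‖g (h.point n)‖ := by ring
      _ ≤ C * D := mul_le_mul h1 (h3.trans h2) (norm_nonneg _) (h0.trans h1)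
  star_mem' := by
    rintro f ⟨hf0, hf⟩
    exact ⟨by simp [hf0], fun q => by simpa using hf q⟩

/-- The function space `C_s(σ(x))`. -/
def FunctionSpace (h : IsSpectralRepresentation x lam P) : Type := ↥h.functionAlgebra

namespace FunctionSpace

variable (h : IsSpectralRepresentation x lam P)

instance : NonUnitalCommRing h.FunctionSpace := inferInstanceAs (NonUnitalCommRing ↥h.functionAlgebra)
instance : Module ℂ h.FunctionSpace := inferInstanceAs (Module ℂ ↥h.functionAlgebra)
instance : IsScalarTower ℂ h.FunctionSpace h.FunctionSpace :=
  inferInstanceAs (IsScalarTower ℂ ↥h.functionAlgebra ↥h.functionAlgebra)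
instance : SMulCommClass ℂ h.FunctionSpace h.FunctionSpace :=
  inferInstanceAs (SMulCommClass ℂ ↥h.functionAlgebra ↥h.functionAlgebra)
instance : StarRing h.FunctionSpace := inferInstanceAs (StarRing ↥h.functionAlgebra)
instance : StarModule ℂ h.FunctionSpace := inferInstanceAs (StarModule ℂ ↥h.functionAlgebra)

/-- The underlying function on `σ(x)`. -/
def toFun : h.FunctionSpace →⋆ₙₐ[ℂ] (quasispectrum ℂ x → ℂ) :=
  NonUnitalStarSubalgebraClass.subtype h.functionAlgebra

instance : CoeFun h.FunctionSpace fun _ => quasispectrum ℂ x → ℂ := ⟨fun f => toFun h f⟩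

theorem toFun_zero_point (f : h.FunctionSpace) : f 0 = 0 := f.2.1

theorem bddAbove (f : h.FunctionSpace) (q : ℕ) :
    BddAbove (Set.range fun n => ‖f (h.point n)‖ * SmoothOp.opNorm q (P n)) := f.2.2 q

/-- The seminorm `c_q(f) = sup_n |f(λ_n)| ‖P_n‖_q`. -/
def seminorm (q : ℕ) : Seminorm ℂ h.FunctionSpace :=
  Seminorm.ofSMulLE (fun f => ⨆ n, ‖f (h.point n)‖ * SmoothOp.opNorm q (P n))
    (by simp)
    (fun f g => ciSup_le fun n => by
      refine le_trans ?_ (add_le_add (le_ciSup (bddAbove h f q) n) (le_ciSup (bddAbove h g q) n))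
      rw [map_add, Pi.add_apply, ← add_mul]
      exact mul_le_mul_of_nonneg_right (norm_add_le _ _) (SmoothOp.opNorm_nonneg _ _))
    (fun c f => ciSup_le fun n => by
      rw [map_smul, Pi.smul_apply, norm_smul, mul_assoc]
      exact mul_le_mul_of_nonneg_left (le_ciSup (bddAbove h f q) n) (norm_nonneg _))

theorem seminorm_apply (q : ℕ) (f : h.FunctionSpace) :
    seminorm h q f = ⨆ n, ‖f (h.point n)‖ * SmoothOp.opNorm q (P n) := rfl

/-- The topology of `C_s(σ(x))` is given by the seminorms `c_q`. -/
instance : TopologicalSpace h.FunctionSpace :=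
  (SeminormFamily.moduleFilterBasis (seminorm h : SeminormFamily ℂ h.FunctionSpace ℕ)).topology

theorem withSeminorms : WithSeminorms (seminorm h : SeminormFamily ℂ h.FunctionSpace ℕ) := ⟨rfl⟩

end FunctionSpace

end IsSpectralRepresentation

end

/-! ### Weighted norms -/

/-! The operator x acts on ℓ² as a compact normal operator, so the Hilbert space spectral theorem
supplies eigenvalues and orthogonal eigenprojections. What remains is to control these projections
in all the norms ‖·‖_q at once. Three estimates for a self-adjoint projection P do this.

(a) |Pξ|_r² ≤ ‖P‖_r |Pξ|_0² (`wnorm_proj_sq_le`), by duality between the weights r and -r. With the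
interpolation inequality |η|_q² ≤ |η|_{2q} |η|_0 it gives ‖P‖_q² ≤ ‖P‖_{2q} (`opNorm_proj_sq_le`).

(b) If xP = cP, then |c| ‖P‖_q ≤ ‖x‖_{2q} (`norm_mul_opNorm_proj_le`): the coefficients of an
operator are controlled by its norms.

(c) For orthogonal nonzero P_n the sum of 1/‖P_n‖_1 is at most ∑ j^{-2} (`summable_inv_opNorm`), by
Bessel's inequality.

By (a) and (c), a bound on sup |c_n| ‖P_n‖_r with r = 2 max(q, 1) makes ∑ c_n P_n absolutely
convergent in ‖·‖_q. By (b), conversely, the norms of the sum bound every sup |c_n| ‖P_n‖_q. So f ↦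
f(x) is a homeomorphism onto its image, and the same two bounds show that the image is closed
(`hasSum_of_mem_closure`). The image contains x, hence alg(x). It is contained in alg(x) because
each P_n is a limit of polynomials in x without constant term (`proj_mem_alg`).

For existence, the eigenprojection E on ℓ² for μ ≠ 0 equals μ⁻² x E x, and so extends to an element
of L(s', s). By (b) the eigenvalues are admissible coefficients, so ∑ μ P_μ converges in L(s', s),
and it agrees with x on all eigenvectors in ℓ², which have dense span. -/

theorem wSummable_wseq {m k : ℤ} {ξ : ℕ → ℂ} : WSummable m (wseq k ξ) ↔ WSummable (m + k) ξ := by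
  unfold WSummable
  refine summable_congr fun j => ?_
  have hj : (0 : ℝ) < (j : ℝ) + 1 := by positivity
  rw [norm_wseq_sq, mul_assoc, ← zpow_add₀ hj.ne']
  congr 2; ring

theorem wnorm_wseq (m k : ℤ) (ξ : ℕ → ℂ) : wnorm m (wseq k ξ) = wnorm (m + k) ξ := by
  unfold wnorm
  congr 1
  refine tsum_congr fun j => ?_
  have hj : (0 : ℝ) < (j : ℝ) + 1 := by positivity
  rw [norm_wseq_sq, mul_assoc, ← zpow_add₀ hj.ne']
  congr 2; ring

theorem wnorm_sq (m : ℤ) (ξ : ℕ → ℂ) :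
    wnorm m ξ ^ 2 = ∑' j : ℕ, ‖ξ j‖ ^ 2 * ((j : ℝ) + 1) ^ (2 * m) :=
  Real.sq_sqrt (tsum_nonneg fun j => by positivity)

theorem wnorm_zero_sq_eq (ξ : ℕ → ℂ) : ((wnorm 0 ξ ^ 2 : ℝ) : ℂ) = ∑' j, ξ j * star (ξ j) := by
  rw [wnorm_sq, Complex.ofReal_tsum]
  refine tsum_congr fun j => ?_
  simp [Complex.mul_conj, Complex.normSq_eq_norm_sq]

/-- Cauchy–Schwarz for the pairing of ξ with itself, the weights m and -m being split between the
two factors. -/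
theorem wnorm_zero_sq_le {m : ℤ} {ξ : ℕ → ℂ} (h : WSummable m ξ) (h' : WSummable (-m) ξ) :
    wnorm 0 ξ ^ 2 ≤ wnorm m ξ * wnorm (-m) ξ := by
  have := (pairing_bound h h').2
  rwa [← wnorm_zero_sq_eq, Complex.norm_real, Real.norm_of_nonneg (by positivity)] at this

/-- The preceding inequality, applied to the sequence (j^m ξ_j), which shifts the weights 0, m, -m
to m, 2m, 0. -/
theorem wnorm_sq_le_interpolation {m : ℤ} {ξ : ℕ → ℂ} (h : WSummable (2 * m) ξ)
    (h' : WSummable 0 ξ) : wnorm m ξ ^ 2 ≤ wnorm (2 * m) ξ * wnorm 0 ξ := by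
  have h1 := wnorm_zero_sq_le (m := m) (ξ := wseq m ξ)
    (wSummable_wseq.2 (by rwa [← two_mul])) (wSummable_wseq.2 (by rwa [neg_add_cancel]))
  simpa only [wnorm_wseq, zero_add, ← two_mul, neg_add_cancel] using h1

theorem wnorm_pos {m : ℤ} {ξ : ℕ → ℂ} (h : WSummable m ξ) (h0 : ξ ≠ 0) : 0 < wnorm m ξ :=
  lt_of_le_of_ne (wnorm_nonneg _ _) fun h1 => h0 (SmoothOp.eq_zero_of_wnorm h h1.symm)

theorem norm_coord_le {m : ℤ} {ξ : ℕ → ℂ} (h : WSummable m ξ) (j : ℕ) :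
    ‖ξ j‖ ≤ wnorm m ξ * ((j : ℝ) + 1) ^ (-m) := by
  have hj : (0 : ℝ) < (j : ℝ) + 1 := by positivity
  have h1 := lp.norm_apply_le_norm (by norm_num) (wl2 m ξ h) j
  rw [norm_wl2] at h1
  have h2 : ‖wl2 m ξ h j‖ = ((j : ℝ) + 1) ^ m * ‖ξ j‖ := by
    change ‖wseq m ξ j‖ = _
    unfold wseq
    rw [norm_mul, Complex.norm_real, Real.norm_of_nonneg (by positivity)]
  rw [h2] at h1
  rw [zpow_neg, ← div_eq_mul_inv, le_div_iff₀ (by positivity), mul_comm]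
  exact h1

/-- All integer weights, not only the nonnegative ones, are summable against a rapidly decreasing
sequence. -/
theorem RapidSeq.wSummable (ξ : RapidSeq) (m : ℤ) : WSummable m ξ.coords :=
  (ξ.summable m.toNat).mono (Int.self_le_toNat m)

/-- The weighted sequence `(j^m ξ_j)` of an element of `s`. -/
noncomputable def RapidSeq.weight (m : ℤ) (ξ : RapidSeq) : RapidSeq :=
  RapidSeq.mk (wseq m ξ.coords) fun _ => wSummable_wseq.2 (ξ.wSummable _)

theorem RapidSeq.wnorm_weight (k m : ℤ) (ξ : RapidSeq) :
    wnorm k (ξ.weight m).coords = wnorm (k + m) ξ.coords :=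
  wnorm_wseq k m _

theorem RapidSeq.wnorm_sq_eq_pairing (m : ℤ) (ξ : RapidSeq) :
    ((wnorm m ξ.coords ^ 2 : ℝ) : ℂ) = pairing ξ (rapidToSlow (ξ.weight (2 * m))) := by
  rw [wnorm_sq, Complex.ofReal_tsum]
  refine tsum_congr fun j => ?_
  simp only [coords_rapidToSlow, weight, coords_mk, wseq, star_mul', Complex.star_def,
    Complex.conj_ofReal]
  rw [← mul_left_comm, Complex.mul_conj, Complex.normSq_eq_norm_sq]
  push_cast
  ring

theorem norm_pairing_le (ξ : RapidSeq) {m : ℤ} {η : SlowSeq} (h : WSummable (-m) η.coords) :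
    ‖pairing ξ η‖ ≤ wnorm m ξ.coords * wnorm (-m) η.coords :=
  (pairing_bound (ξ.wSummable m) h).2

namespace SmoothOp

/-! ### Estimates for projections -/

variable {P x : SmoothOp}

theorem apply_apply_of_isIdempotentElem (hP : IsIdempotentElem P) (ξ : SlowSeq) :
    P (rapidToSlow (P ξ)) = P ξ := by
  rw [← mul_apply, hP.eq]

/-- Since P = P* = P², |Pξ|_0² equals ⟨Pξ, ξ⟩ up to conjugation, and Cauchy–Schwarz with weights m
and -m applies. -/
theorem wnorm_zero_proj_sq_le (hP : IsStarProjection P) {m : ℤ} {ξ : SlowSeq}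
    (h : WSummable (-m) ξ.coords) :
    wnorm 0 (P ξ).coords ^ 2 ≤ wnorm m (P ξ).coords * wnorm (-m) ξ.coords := by
  have h1 : ((wnorm 0 (P ξ).coords ^ 2 : ℝ) : ℂ) = star (pairing (P ξ) ξ) := by
    rw [wnorm_zero_sq_eq]
    change pairing (P ξ) (rapidToSlow (P ξ)) = _
    rw [pairing_star, hP.isSelfAdjoint.star_eq,
      apply_apply_of_isIdempotentElem hP.isIdempotentElem]
  have h2 := norm_pairing_le (P ξ) h
  rwa [← norm_star, ← h1, Complex.norm_real, Real.norm_of_nonneg (by positivity)] at h2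

/-- This is the T T* identity in disguise: P = P P* factors through ℓ², so ‖P‖_r dominates the
square of the norm of P from ℓ² to the space with norm |·|_r. -/
theorem wnorm_proj_sq_le (hP : IsStarProjection P) (r : ℕ) (ξ : SlowSeq) :
    wnorm r (P ξ).coords ^ 2 ≤ opNorm r P * wnorm 0 (P ξ).coords ^ 2 := by
  set η := P ξ with hη
  -- The vector dual to η for the weight r: ⟨η, ζ⟩ = |η|_r² while |ζ|'_r = |η|_r.
  set ζ := rapidToSlow (η.weight (2 * (r : ℤ))) with hζ
  have hζn : wnorm (-(r : ℤ)) ζ.coords = wnorm r η.coords := by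
    rw [hζ, coords_rapidToSlow, RapidSeq.wnorm_weight]
    congr 1; ring
  have hζs : WSummable (-(r : ℤ)) ζ.coords := RapidSeq.wSummable _ _
  have h1 : wnorm r η.coords ^ 2 ≤ wnorm 0 (P ζ).coords * wnorm 0 η.coords := by
    have h := RapidSeq.wnorm_sq_eq_pairing r η
    rw [← hζ] at h
    have hfix : pairing η ζ = star (pairing (P ζ) (rapidToSlow η)) := by
      conv_lhs => rw [hη, ← apply_apply_of_isIdempotentElem hP.isIdempotentElem, ← hη]
      rw [pairing_star, hP.isSelfAdjoint.star_eq]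
    have h2 := norm_pairing_le (P ζ) (m := 0) (η := rapidToSlow η) (η.wSummable _)
    rw [← norm_star, ← hfix, ← h, Complex.norm_real, Real.norm_of_nonneg (by positivity),
      neg_zero] at h2
    exact h2
  have h2 : wnorm 0 (P ζ).coords ^ 2 ≤ opNorm r P * wnorm r η.coords ^ 2 := by
    have h := wnorm_zero_proj_sq_le hP hζs
    have h' := le_opNorm r P hζs
    rw [hζn] at h h'
    refine h.trans ?_
    rw [sq, ← mul_assoc]
    exact mul_le_mul_of_nonneg_right h' (wnorm_nonneg _ _)
  rcases (wnorm_nonneg r η.coords).eq_or_lt with h0 | h0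
  · rw [← h0, zero_pow two_ne_zero]
    have := opNorm_nonneg r P
    positivity
  · have h3 : (wnorm r η.coords ^ 2) * wnorm r η.coords ^ 2
        ≤ (opNorm r P * wnorm 0 η.coords ^ 2) * wnorm r η.coords ^ 2 := by
      calc (wnorm r η.coords ^ 2) * wnorm r η.coords ^ 2
          ≤ (wnorm 0 (P ζ).coords * wnorm 0 η.coords) * (wnorm 0 (P ζ).coords * wnorm 0 η.coords) :=
            mul_self_le_mul_self (by positivity) h1
        _ = wnorm 0 (P ζ).coords ^ 2 * wnorm 0 η.coords ^ 2 := by ring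
        _ ≤ (opNorm r P * wnorm r η.coords ^ 2) * wnorm 0 η.coords ^ 2 := by gcongr
        _ = _ := by ring
    exact le_of_mul_le_mul_right h3 (by positivity)

theorem wnorm_zero_proj_sq_le_of_unit (hP : IsStarProjection P) {q : ℕ} {ξ : SlowSeq}
    (h : WSummable (-(q : ℤ)) ξ.coords) (h1 : wnorm (-(q : ℤ)) ξ.coords ≤ 1) :
    wnorm 0 (P ξ).coords ^ 2 ≤ wnorm q (P ξ).coords :=
  (wnorm_zero_proj_sq_le hP h).trans (mul_le_of_le_one_right (wnorm_nonneg _ _) h1)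

/-- For η = Pξ with |ξ|'_q ≤ 1, interpolation gives |η|_q² ≤ |η|_{2q} |η|_0 ≤ ‖P‖_{2q}^{1/2} |η|_0²,
and |η|_0² ≤ |η|_q; one factor |η|_q cancels. -/
theorem opNorm_proj_sq_le (hP : IsStarProjection P) (q : ℕ) :
    opNorm q P ^ 2 ≤ opNorm (2 * q) P := by
  have hnn := opNorm_nonneg (2 * q) P
  refine (Real.le_sqrt (opNorm_nonneg q P) hnn).1 (opNorm_le q P fun ξ hs h1 => ?_)
  set η := P ξ with hη
  have ha := wnorm_sq_le_interpolation (m := q) (η.wSummable _) (η.wSummable _)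
  have hb := wnorm_proj_sq_le hP (2 * q) ξ
  have hc := wnorm_zero_proj_sq_le_of_unit hP hs h1
  rw [← hη] at hb hc
  push_cast at hb
  have hb' : wnorm (2 * q) η.coords ≤ √(opNorm (2 * q) P) * wnorm 0 η.coords := by
    rw [← Real.sqrt_sq (wnorm_nonneg 0 η.coords), ← Real.sqrt_mul hnn]
    exact Real.le_sqrt_of_sq_le hb
  rcases (wnorm_nonneg q η.coords).eq_or_lt with h0 | h0
  · rw [← h0]; positivity
  · refine le_of_mul_le_mul_right ?_ h0
    calc wnorm q η.coords * wnorm q η.coords ≤ wnorm (2 * q) η.coords * wnorm 0 η.coords := by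
          rw [← sq]; exact ha
      _ ≤ √(opNorm (2 * q) P) * wnorm 0 η.coords * wnorm 0 η.coords :=
          mul_le_mul_of_nonneg_right hb' (wnorm_nonneg _ _)
      _ = √(opNorm (2 * q) P) * wnorm 0 η.coords ^ 2 := by ring
      _ ≤ _ := mul_le_mul_of_nonneg_left hc (Real.sqrt_nonneg _)

/-- The same argument as for ‖P‖_q² ≤ ‖P‖_{2q}, except that |η|_{2q} is now bounded through the
eigenvector equation xη = cη. -/
theorem norm_mul_opNorm_proj_le (hP : IsStarProjection P) {c : ℂ} (h : x * P = c • P) (q : ℕ) :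
    ‖c‖ * opNorm q P ≤ opNorm (2 * q) x := by
  rcases (norm_nonneg c).eq_or_lt with h0 | hc0
  · rw [← h0, zero_mul]; exact opNorm_nonneg _ _
  rw [← le_div_iff₀' hc0]
  refine opNorm_le q P fun ξ hs h1 => ?_
  rw [le_div_iff₀' hc0]
  set η := P ξ with hη
  have ha := wnorm_sq_le_interpolation (m := q) (η.wSummable _) (η.wSummable _)
  have hc := wnorm_zero_proj_sq_le_of_unit hP hs h1
  rw [← hη] at hc
  have hxη : x (rapidToSlow η) = c • η := by
    rw [hη, ← mul_apply, h, smul_apply]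
  have hb := le_opNorm (2 * q) x (ξ := rapidToSlow η) (η.wSummable _)
  rw [hxη, map_smul, wnorm_smul, coords_rapidToSlow] at hb
  push_cast at hb
  -- The bound of x is weakened by |η|'_{2q} ≤ |η|_0, which is the norm that interpolation needs.
  have hb' : ‖c‖ * wnorm (2 * q) η.coords ≤ opNorm (2 * q) x * wnorm 0 η.coords :=
    hb.trans (mul_le_mul_of_nonneg_left (wnorm_mono (by omega) (η.wSummable _))
      (opNorm_nonneg _ _))
  rcases (wnorm_nonneg q η.coords).eq_or_lt with h0 | h0
  · rw [← h0, mul_zero]; exact opNorm_nonneg _ _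
  · refine le_of_mul_le_mul_right ?_ h0
    calc ‖c‖ * wnorm q η.coords * wnorm q η.coords = ‖c‖ * wnorm q η.coords ^ 2 := by ring
      _ ≤ ‖c‖ * (wnorm (2 * q) η.coords * wnorm 0 η.coords) := by gcongr
      _ = (‖c‖ * wnorm (2 * q) η.coords) * wnorm 0 η.coords := by ring
      _ ≤ (opNorm (2 * q) x * wnorm 0 η.coords) * wnorm 0 η.coords :=
          mul_le_mul_of_nonneg_right hb' (wnorm_nonneg _ _)
      _ = opNorm (2 * q) x * wnorm 0 η.coords ^ 2 := by ring
      _ ≤ _ := mul_le_mul_of_nonneg_left hc (opNorm_nonneg _ _)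

theorem opNorm_mono {q r : ℕ} (h : q ≤ r) (x : SmoothOp) : opNorm q x ≤ opNorm r x := by
  refine opNorm_le q x fun ξ h1 h2 => ?_
  have h1' : WSummable (-(r : ℤ)) ξ.coords := h1.mono (by omega)
  exact (wnorm_mono (by omega) ((x ξ).wSummable r)).trans (le_opNorm_of_unit r x h1'
    ((wnorm_mono (by omega) h1).trans h2))

/-! ### Orthogonal families of projections -/

theorem summable_weight_neg_two : Summable fun j : ℕ => ((j : ℝ) + 1) ^ (-2 : ℤ) := by
  have := (summable_nat_add_iff 1).2 (Real.summable_nat_pow_inv (p := 2).2 (by norm_num))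
  refine this.congr fun j => ?_
  rw [zpow_neg]; push_cast; norm_cast

/-- An element of `s` as an element of `ℓ²`. -/
noncomputable def _root_.RapidSeq.toL2 (ξ : RapidSeq) : lp (fun _ : ℕ => ℂ) 2 := wl2 0 ξ.coords (ξ.wSummable 0)

theorem _root_.RapidSeq.toL2_apply (ξ : RapidSeq) (j : ℕ) : ξ.toL2 j = ξ j := by
  change wseq 0 ξ.coords j = _
  simp [wseq]

theorem _root_.RapidSeq.norm_toL2 (ξ : RapidSeq) : ‖ξ.toL2‖ = wnorm 0 ξ.coords := norm_wl2 _

theorem _root_.RapidSeq.inner_toL2 (ξ η : RapidSeq) :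
    inner ℂ ξ.toL2 η.toL2 = pairing η (rapidToSlow ξ) := by
  rw [lp.inner_eq_tsum]
  refine tsum_congr fun j => ?_
  simp [RapidSeq.toL2_apply]

theorem exists_unit_of_ne_zero (hP : IsStarProjection P) (h0 : P ≠ 0) :
    ∃ e : RapidSeq, P (rapidToSlow e) = e ∧ wnorm 0 e.coords = 1 := by
  have hex : ∃ ξ, P ξ ≠ 0 := by
    by_contra hcon
    push Not at hcon
    exact h0 (ext hcon)
  obtain ⟨ξ, hξ⟩ := hex
  have hpos : 0 < wnorm 0 (P ξ).coords :=
    wnorm_pos ((P ξ).wSummable 0) fun h => hξ (RapidSeq.ext (by rw [h, map_zero]))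
  refine ⟨(((wnorm 0 (P ξ).coords)⁻¹ : ℝ) : ℂ) • P ξ, ?_, ?_⟩
  · rw [map_smul, map_smul, apply_apply_of_isIdempotentElem hP.isIdempotentElem]
  · rw [map_smul, wnorm_smul, Complex.norm_real, Real.norm_of_nonneg (by positivity),
      inv_mul_cancel₀ hpos.ne']

theorem one_le_opNorm_proj (hP : IsStarProjection P) (h0 : P ≠ 0) (q : ℕ) : 1 ≤ opNorm q P := by
  obtain ⟨e, he, he1⟩ := exists_unit_of_ne_zero hP h0
  have h1 := wnorm_proj_sq_le hP q (rapidToSlow e)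
  rw [he, he1, one_pow, mul_one] at h1
  refine le_trans ?_ h1
  have : 1 ≤ wnorm q e.coords := he1 ▸ wnorm_mono (by omega) (e.wSummable q)
  nlinarith

/-- One unit vector e_i is taken from the range of each projection; these are orthonormal. Each
1/‖P_i‖_1 is at most |e_i|_{-1}², and by Bessel's inequality in every coordinate ∑_i |e_i|_{-1}² ≤
∑_j j^{-2}. -/
theorem summable_inv_opNorm {ι : Type*} {P : ι → SmoothOp} (hP : ∀ i, IsStarProjection (P i))
    (h0 : ∀ i, P i ≠ 0) (horth : ∀ i j, i ≠ j → P i * P j = 0) :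
    Summable fun i => (opNorm 1 (P i))⁻¹ := by
  choose e he he1 using fun i => exists_unit_of_ne_zero (hP i) (h0 i)
  have hon : Orthonormal ℂ fun i => (e i).toL2 := by
    refine ⟨fun i => by rw [RapidSeq.norm_toL2, he1], fun i j hij => ?_⟩
    dsimp only
    rw [RapidSeq.inner_toL2]
    conv_lhs => rw [← he j]
    rw [pairing_star, (hP j).isSelfAdjoint.star_eq, ← he i, ← mul_apply, horth j i hij.symm]
    simp [pairing]
  have hbessel : ∀ (s : Finset ι) (j : ℕ), ∑ i ∈ s, ‖e i j‖ ^ 2 ≤ 1 := by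
    intro s j
    have h := hon.sum_inner_products_le (lp.single 2 j (1 : ℂ)) (s := s)
    rw [lp.norm_single (by norm_num)] at h
    simp only [norm_one, one_pow] at h
    refine le_trans (Finset.sum_le_sum fun i _ => ?_) h
    rw [lp.inner_single_right, RapidSeq.toL2_apply]
    simp
  -- Here 1 = |e|_0⁴ ≤ |e|_1² |e|_{-1}² and |e|_1² ≤ ‖P‖_1.
  have hterm : ∀ i, (opNorm 1 (P i))⁻¹ ≤ wnorm (-1) (e i).coords ^ 2 := by
    intro i
    have hpos := zero_lt_one.trans_le (one_le_opNorm_proj (hP i) (h0 i) 1)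
    rw [inv_le_iff_one_le_mul₀ hpos]
    have h1 := wnorm_zero_sq_le (m := 1) ((e i).wSummable 1) ((e i).wSummable (-1))
    have h2 := wnorm_proj_sq_le (hP i) 1 (rapidToSlow (e i))
    rw [he, he1, one_pow, mul_one] at h2
    rw [he1, one_pow] at h1
    push_cast at h2
    calc (1 : ℝ) = 1 * 1 := by norm_num
      _ ≤ (wnorm 1 (e i).coords * wnorm (-1) (e i).coords)
          * (wnorm 1 (e i).coords * wnorm (-1) (e i).coords) :=
          mul_le_mul h1 h1 zero_le_one (zero_le_one.trans h1)
      _ = wnorm (-1) (e i).coords ^ 2 * wnorm 1 (e i).coords ^ 2 := by ring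
      _ ≤ _ := mul_le_mul_of_nonneg_left h2 (by positivity)
  have hsum : ∀ i, Summable fun j : ℕ => ‖e i j‖ ^ 2 * ((j : ℝ) + 1) ^ (-2 : ℤ) :=
    fun i => by simpa [WSummable] using (e i).wSummable (-1)
  refine summable_of_sum_le (c := ∑' j : ℕ, ((j : ℝ) + 1) ^ (-2 : ℤ))
    (fun i => inv_nonneg.2 (opNorm_nonneg _ _)) fun s => ?_
  calc ∑ i ∈ s, (opNorm 1 (P i))⁻¹ ≤ ∑ i ∈ s, wnorm (-1) (e i).coords ^ 2 :=
        Finset.sum_le_sum fun i _ => hterm i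
    _ = ∑ i ∈ s, ∑' j : ℕ, ‖e i j‖ ^ 2 * ((j : ℝ) + 1) ^ (-2 : ℤ) := by
        refine Finset.sum_congr rfl fun i _ => ?_
        rw [wnorm_sq]; norm_num
    _ = ∑' j : ℕ, ∑ i ∈ s, ‖e i j‖ ^ 2 * ((j : ℝ) + 1) ^ (-2 : ℤ) :=
        (Summable.tsum_finsetSum fun i _ => hsum i).symm
    _ ≤ _ := by
        refine Summable.tsum_le_tsum (fun j => ?_)
          (summable_sum fun i _ => hsum i) summable_weight_neg_two
        rw [← Finset.sum_mul]
        exact mul_le_of_le_one_left (by positivity) (hbessel s j)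

end SmoothOp

/-! ### Countable families of seminorms -/

section Seminorms

variable {E : Type*} [AddCommGroup E] [Module ℂ E] [TopologicalSpace E]

theorem Seminorm.map_finset_sum_le {E : Type*} [AddCommGroup E] [Module ℂ E] (p : Seminorm ℂ E)
    {ι : Type*} (s : Finset ι) (f : ι → E) : p (∑ i ∈ s, f i) ≤ ∑ i ∈ s, p (f i) :=
  Finset.le_sum_of_subadditive p (map_zero p).le (map_add_le_add p) s f

theorem WithSeminorms.metrizableSpace [T2Space E] {p : SeminormFamily ℂ E ℕ}
    (hp : WithSeminorms p) : TopologicalSpace.MetrizableSpace E := by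
  have := hp.topologicalAddGroup
  have := hp.firstCountableTopology
  let := IsTopologicalAddGroup.rightUniformSpace E
  have := isUniformAddGroup_of_addCommGroup (G := E)
  have := IsUniformAddGroup.uniformity_countably_generated (α := E)
  infer_instance

/-- Countably many seminorms make the uniformity countably generated, so Cauchy sequences decide
completeness. -/
theorem WithSeminorms.completeSpace [IsTopologicalAddGroup E] {p : SeminormFamily ℂ E ℕ}
    (hp : WithSeminorms p)
    (h : ∀ u : ℕ → E, (∀ q, ∀ ε > 0, ∃ N, ∀ m ≥ N, ∀ n ≥ N, p q (u m - u n) < ε) →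
      ∃ a, Tendsto u atTop (𝓝 a)) :
    @CompleteSpace E (IsTopologicalAddGroup.rightUniformSpace E) := by
  have := hp.firstCountableTopology
  let := IsTopologicalAddGroup.rightUniformSpace E
  have := isUniformAddGroup_of_addCommGroup (G := E)
  have := IsUniformAddGroup.uniformity_countably_generated (α := E)
  refine UniformSpace.complete_of_cauchySeq_tendsto fun u hu => h u fun q ε hε => ?_
  have hV : {z : E × E | p q (z.1 - z.2) < ε} ∈ uniformity E := by
    rw [uniformity_eq_comap_nhds_zero_swapped]
    refine ⟨{y | p q y < ε}, ?_, fun z hz => hz⟩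
    exact ((hp.continuous_seminorm q).tendsto 0).eventually_lt_const (by simpa using hε)
  obtain ⟨N, hN⟩ := (cauchySeq_iff.1 hu) _ hV
  exact ⟨N, fun m hm n hn => hN m hm n hn⟩

theorem WithSeminorms.summable_of_summable_seminorm [IsTopologicalAddGroup E]
    {p : SeminormFamily ℂ E ℕ} (hp : WithSeminorms p)
    (hc : @CompleteSpace E (IsTopologicalAddGroup.rightUniformSpace E)) {ι : Type*} {f : ι → E}
    (hf : ∀ q, Summable fun i => p q (f i)) : Summable f := by
  let := IsTopologicalAddGroup.rightUniformSpace E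
  have := isUniformAddGroup_of_addCommGroup (G := E)
  rw [summable_iff_vanishing]
  intro U hU
  obtain ⟨s, r, hr, hs⟩ := (hp.mem_nhds_iff _ _).1 hU
  have hsum : Summable fun i => ∑ q ∈ s, p q (f i) := summable_sum fun q _ => hf q
  obtain ⟨F, hF⟩ := summable_iff_vanishing.1 hsum (Metric.ball 0 r) (Metric.ball_mem_nhds _ hr)
  refine ⟨F, fun t ht => hs ?_⟩
  rw [Seminorm.mem_ball_zero]
  calc (s.sup p) (∑ i ∈ t, f i) ≤ (∑ q ∈ s, p q) (∑ i ∈ t, f i) := Seminorm.finset_sup_le_sum _ _ _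
    _ = ∑ q ∈ s, p q (∑ i ∈ t, f i) := by
      rw [← FunLike.coeAddMonoidHom_apply, map_sum, Finset.sum_apply]
      rfl
    _ ≤ ∑ q ∈ s, ∑ i ∈ t, p q (f i) := Finset.sum_le_sum fun q _ => Seminorm.map_finset_sum_le _ _ _
    _ = ∑ i ∈ t, ∑ q ∈ s, p q (f i) := Finset.sum_comm
    _ < r := by
      have := hF t ht
      rw [mem_ball_zero_iff] at this
      exact (le_abs_self _).trans_lt this

theorem WithSeminorms.seminorm_le_of_hasSum {p : SeminormFamily ℂ E ℕ} (hp : WithSeminorms p)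
    {ι : Type*} {f : ι → E} {a : E} (h : HasSum f a) (q : ℕ) (hf : Summable fun i => p q (f i)) :
    p q a ≤ ∑' i, p q (f i) := by
  refine le_of_tendsto (((hp.continuous_seminorm q).tendsto a).comp h)
    (Eventually.of_forall fun s => ?_)
  exact (Seminorm.map_finset_sum_le _ _ _).trans (hf.sum_le_tsum s fun i _ => apply_nonneg _ _)

end Seminorms

namespace SmoothOp

/-! ### Completeness of `L(s', s)` -/

/-- The exponent keeps one weight more than q, so that `wnorm_le_of_coord` can turn coordinate
bounds back into a bound of |·|_q. -/
theorem norm_apply_coord_le (x : SmoothOp) (q k : ℕ) {ξ : SlowSeq}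
    (h : WSummable (-(k : ℤ)) ξ.coords) (j : ℕ) :
    ‖x ξ j‖ ≤ opNorm (max k (q + 1)) x * wnorm (-(k : ℤ)) ξ.coords
      * ((j : ℝ) + 1) ^ (-((q : ℤ) + 1)) := by
  set r := max k (q + 1) with hr
  have hkr : k ≤ r := le_max_left _ _
  have hqr : q + 1 ≤ r := le_max_right _ _
  have h1 := norm_coord_le ((x ξ).wSummable r) j
  have h2 := le_opNorm r x (h.mono (by omega))
  have h3 : ((j : ℝ) + 1) ^ (-(r : ℤ)) ≤ ((j : ℝ) + 1) ^ (-((q : ℤ) + 1)) :=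
    zpow_le_zpow_right₀ (by linarith [(Nat.cast_nonneg j : (0 : ℝ) ≤ j)]) (by omega)
  have h4 : wnorm (-(r : ℤ)) ξ.coords ≤ wnorm (-(k : ℤ)) ξ.coords := wnorm_mono (by omega) h
  exact h1.trans (mul_le_mul (h2.trans (mul_le_mul_of_nonneg_left h4 (opNorm_nonneg _ _))) h3
    (by positivity) (mul_nonneg (opNorm_nonneg _ _) (wnorm_nonneg _ _)))

/-- The limit is built coordinate by coordinate. Norm bounds along the sequence pass to the
coordinates of the limit and place it in L(s', s). -/
theorem exists_tendsto_of_cauchy (u : ℕ → SmoothOp)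
    (hu : ∀ q, ∀ ε > 0, ∃ N, ∀ m ≥ N, ∀ n ≥ N, norm q (u m - u n) < ε) :
    ∃ a, Tendsto u atTop (𝓝 a) := by
  have hbdd : ∀ q, ∃ M, 0 ≤ M ∧ ∃ N, ∀ n ≥ N, opNorm q (u n) ≤ M := by
    intro q
    obtain ⟨N, hN⟩ := hu q 1 one_pos
    refine ⟨1 + opNorm q (u N), by linarith [opNorm_nonneg q (u N)], N, fun n hn => ?_⟩
    have h1 := map_add_le_add (norm q) (u n - u N) (u N)
    rw [sub_add_cancel] at h1
    simp only [norm_apply] at h1 hN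
    linarith [hN n hn N le_rfl]
  have hlim : ∀ (ξ : SlowSeq) (j : ℕ), ∃ z : ℂ, Tendsto (fun n => u n ξ j) atTop (𝓝 z) := by
    intro ξ j
    obtain ⟨k, hk⟩ := ξ.summable
    refine cauchySeq_tendsto_of_complete (Metric.cauchySeq_iff.2 fun ε hε => ?_)
    set C := wnorm (-(k : ℤ)) ξ.coords * ((j : ℝ) + 1) ^ (-((0 : ℕ) + 1 : ℤ)) with hC
    have hC0 : 0 ≤ C := mul_nonneg (wnorm_nonneg _ _) (by positivity)
    obtain ⟨N, hN⟩ := hu (max k (0 + 1)) (ε / (C + 1)) (by positivity)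
    refine ⟨N, fun m hm n hn => ?_⟩
    have h1 := norm_apply_coord_le (u m - u n) 0 k hk j
    rw [sub_apply, map_sub, Pi.sub_apply, mul_assoc, ← hC] at h1
    rw [dist_eq_norm]
    refine h1.trans_lt ?_
    have h2 := hN m hm n hn
    rw [norm_apply, lt_div_iff₀ (by positivity)] at h2
    nlinarith [opNorm_nonneg (max k (0 + 1)) (u m - u n)]
  choose L hL using hlim
  -- Used twice: with v = u it shows that the limit is a smooth operator, and with v_m = u_n - u_m
  -- it estimates the distance of u_n from the limit.
  have hLbound : ∀ (q k : ℕ) (M : ℝ) (v : ℕ → SmoothOp) (w : ℕ → ℂ) (ξ : SlowSeq), 0 ≤ M →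
      (∃ N, ∀ n ≥ N, opNorm (max k (q + 1)) (v n) ≤ M) → WSummable (-(k : ℤ)) ξ.coords →
      (∀ j, Tendsto (fun n => v n ξ j) atTop (𝓝 (w j))) →
      ∀ j, ‖w j‖ ≤ M * wnorm (-(k : ℤ)) ξ.coords * ((j : ℝ) + 1) ^ (-((q : ℤ) + 1)) := by
    rintro q k M v w ξ hM ⟨N, hN⟩ hξ hw j
    refine le_of_tendsto (hw j).norm ?_
    filter_upwards [eventually_ge_atTop N] with n hn
    refine (norm_apply_coord_le (v n) q k hξ j).trans ?_
    have := wnorm_nonneg (-(k : ℤ)) ξ.coords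
    gcongr
    exact hN n hn
  have hLs : ∀ ξ q, WSummable (q : ℕ) (L ξ) := by
    intro ξ q
    obtain ⟨k, hk⟩ := ξ.summable
    obtain ⟨M, hM0, hM⟩ := hbdd (max k (q + 1))
    exact (wnorm_le_of_coord (mul_nonneg hM0 (wnorm_nonneg _ _))
      (hLbound q k M u (L ξ) ξ hM0 hM hk (hL ξ))).1
  let f : SlowSeq →ₗ[ℂ] RapidSeq :=
    { toFun := fun ξ => RapidSeq.mk (L ξ) (hLs ξ)
      map_add' := fun ξ η => RapidSeq.ext <| by
        funext j
        refine tendsto_nhds_unique (hL (ξ + η) j) ?_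
        simp only [map_add]
        exact (hL ξ j).add (hL η j)
      map_smul' := fun c ξ => RapidSeq.ext <| by
        funext j
        refine tendsto_nhds_unique (hL (c • ξ) j) ?_
        simp only [map_smul]
        exact (hL ξ j).const_smul c }
  let a : SmoothOp := ofBound f fun q k => by
    obtain ⟨M, hM0, hM⟩ := hbdd (max k (q + 1))
    refine ⟨√(∑' j : ℕ, ((j : ℝ) + 1) ^ (-2 : ℤ)) * M, fun ξ hk => ?_⟩
    rw [mul_assoc]
    exact (wnorm_le_of_coord (mul_nonneg hM0 (wnorm_nonneg _ _))
      (hLbound q k M u (L ξ) ξ hM0 hM hk (hL ξ))).2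
  have ha : ∀ ξ j, a ξ j = L ξ j := fun _ _ => rfl
  refine ⟨a, ?_⟩
  rw [withSeminorms.tendsto_nhds]
  intro q ε hε
  set C := √(∑' j : ℕ, ((j : ℝ) + 1) ^ (-2 : ℤ)) with hC
  have hC0 : 0 ≤ C := Real.sqrt_nonneg _
  -- Passing through coordinates costs one weight, whence q + 1, and the constant C, whence ε / (C +
  -- 1).
  obtain ⟨N, hN⟩ := hu (q + 1) (ε / (C + 1)) (by positivity)
  filter_upwards [eventually_ge_atTop N] with n hn
  have hle : opNorm q (u n - a) ≤ C * (ε / (C + 1)) := by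
    refine opNorm_le q _ fun ξ h1 h2 => ?_
    have hM0 : 0 ≤ ε / (C + 1) := by positivity
    have h3 := (wnorm_le_of_coord (mul_nonneg hM0 (wnorm_nonneg _ _))
      (hLbound q q (ε / (C + 1)) (fun m => u n - u m) ((u n - a) ξ).coords ξ hM0
        ⟨N, fun m hm => by
          rw [max_eq_right (Nat.le_succ q)]
          exact (hN n hn m hm).le⟩ h1 fun j => by
          simp only [sub_apply, map_sub, Pi.sub_apply, ha]
          exact (hL ξ j).const_sub _)).2
    refine h3.trans (mul_le_mul_of_nonneg_left ?_ hC0)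
    exact mul_le_of_le_one_right hM0 h2
  refine hle.trans_lt ?_
  rw [mul_div_assoc', div_lt_iff₀ (by positivity)]
  nlinarith

theorem completeSpace : @CompleteSpace SmoothOp (IsTopologicalAddGroup.rightUniformSpace SmoothOp) :=
  withSeminorms.completeSpace exists_tendsto_of_cauchy

/-! ### Series of orthogonal projections -/

/-- A sequence of pairwise orthogonal nonzero self-adjoint projections. -/
structure IsOrthogonalFamily (P : ℕ → SmoothOp) : Prop where
  isStarProjection : ∀ n, IsStarProjection (P n)
  ne_zero : ∀ n, P n ≠ 0
  orthogonal : ∀ m n, m ≠ n → P m * P n = 0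

/-- `sup_n |c_n| ‖P_n‖_q < ∞` for all `q`. -/
def IsCoeff (P : ℕ → SmoothOp) (c : ℕ → ℂ) : Prop :=
  ∀ q, ∃ C, ∀ n, ‖c n‖ * opNorm q (P n) ≤ C

variable {P : ℕ → SmoothOp} {c d : ℕ → ℂ}

namespace IsOrthogonalFamily

/-- A constant `A` for which `‖∑ c_n P_n‖_q ≤ A sup_n |c_n| ‖P_n‖_r`, where
`r = 2 max(q, 1)`. -/
noncomputable def const (P : ℕ → SmoothOp) : ℝ := ∑' n, (opNorm 1 (P n))⁻¹

theorem const_nonneg (P : ℕ → SmoothOp) : 0 ≤ const P :=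
  tsum_nonneg fun _ => inv_nonneg.2 (opNorm_nonneg _ _)

theorem summable_inv (hP : IsOrthogonalFamily P) : Summable fun n => (opNorm 1 (P n))⁻¹ :=
  summable_inv_opNorm hP.isStarProjection hP.ne_zero hP.orthogonal

theorem one_le_opNorm (hP : IsOrthogonalFamily P) (n q : ℕ) : 1 ≤ opNorm q (P n) :=
  one_le_opNorm_proj (hP.isStarProjection n) (hP.ne_zero n) q

/-- With r = max(q, 1), ‖P_n‖_q ‖P_n‖_1 ≤ ‖P_n‖_r² ≤ ‖P_n‖_{2r}. The gained factor 1/‖P_n‖_1 is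
summable, so bounded coefficients for 2r give absolute convergence for q. -/
theorem norm_mul_opNorm_le (hP : IsOrthogonalFamily P) (q n : ℕ) (c : ℂ) :
    ‖c‖ * opNorm q (P n) ≤ ‖c‖ * opNorm (2 * max q 1) (P n) * (opNorm 1 (P n))⁻¹ := by
  have h1 : 0 < opNorm 1 (P n) := zero_lt_one.trans_le (hP.one_le_opNorm n 1)
  rw [← div_eq_mul_inv, le_div_iff₀ h1, mul_assoc]
  refine mul_le_mul_of_nonneg_left ?_ (norm_nonneg _)
  refine le_trans ?_ (opNorm_proj_sq_le (hP.isStarProjection n) (max q 1))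
  rw [sq]
  exact mul_le_mul (opNorm_mono (le_max_left _ _) _) (opNorm_mono (le_max_right _ _) _) h1.le
    (opNorm_nonneg _ _)

theorem summable_opNorm_and_le (hP : IsOrthogonalFamily P) {q : ℕ} {C : ℝ}
    (h : ∀ n, ‖c n‖ * opNorm (2 * max q 1) (P n) ≤ C) :
    (Summable fun n => norm q (c n • P n)) ∧ ∑' n, norm q (c n • P n) ≤ C * const P := by
  have hle : ∀ n, norm q (c n • P n) ≤ C * (opNorm 1 (P n))⁻¹ := by
    intro n
    rw [map_smul_eq_mul, norm_apply]
    exact (hP.norm_mul_opNorm_le q n (c n)).trans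
      (mul_le_mul_of_nonneg_right (h n) (inv_nonneg.2 (opNorm_nonneg _ _)))
  have hs := Summable.of_nonneg_of_le (fun n => apply_nonneg _ _) hle (hP.summable_inv.mul_left C)
  refine ⟨hs, ?_⟩
  rw [const, ← tsum_mul_left]
  exact hs.tsum_le_tsum hle (hP.summable_inv.mul_left C)

theorem summable (hP : IsOrthogonalFamily P) (hc : IsCoeff P c) :
    Summable fun n => c n • P n :=
  withSeminorms.summable_of_summable_seminorm completeSpace fun q => by
    obtain ⟨C, hC⟩ := hc (2 * max q 1)
    exact (hP.summable_opNorm_and_le hC).1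

theorem opNorm_le_of_hasSum (hP : IsOrthogonalFamily P) {y : SmoothOp}
    (hy : HasSum (fun n => c n • P n) y) {q : ℕ} {C : ℝ}
    (h : ∀ n, ‖c n‖ * opNorm (2 * max q 1) (P n) ≤ C) : opNorm q y ≤ C * const P :=
  have h1 := hP.summable_opNorm_and_le h
  (withSeminorms.seminorm_le_of_hasSum hy q h1.1).trans h1.2

theorem mul_proj_of_hasSum (hP : IsOrthogonalFamily P) {y : SmoothOp}
    (hy : HasSum (fun n => c n • P n) y) (n : ℕ) : y * P n = c n • P n := by
  refine (hy.mul_right (P n)).unique ?_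
  convert hasSum_single n ?_ using 1
  · rw [smul_mul_assoc, (hP.isStarProjection n).isIdempotentElem.eq]
  · intro m hm
    rw [smul_mul_assoc, hP.orthogonal m n hm, smul_zero]

theorem norm_coeff_mul_opNorm_le (hP : IsOrthogonalFamily P) {y : SmoothOp} {n : ℕ} {a : ℂ}
    (hy : y * P n = a • P n) (q : ℕ) : ‖a‖ * opNorm q (P n) ≤ opNorm (2 * q) y :=
  norm_mul_opNorm_proj_le (hP.isStarProjection n) hy q

theorem isCoeff_of_mul_proj (hP : IsOrthogonalFamily P) {y : SmoothOp}
    (hy : ∀ n, y * P n = c n • P n) : IsCoeff P c := fun q =>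
  ⟨opNorm (2 * q) y, fun n => hP.norm_coeff_mul_opNorm_le (hy n) q⟩

theorem hasSum_mul (hP : IsOrthogonalFamily P) {y z : SmoothOp}
    (hy : HasSum (fun n => c n • P n) y) (hz : HasSum (fun n => d n • P n) z) :
    HasSum (fun n => (c n * d n) • P n) (y * z) := by
  convert hz.mul_left y using 1
  funext n
  rw [mul_smul_comm, hP.mul_proj_of_hasSum hy, smul_smul, mul_comm]

theorem hasSum_star (hP : IsOrthogonalFamily P) {y : SmoothOp}
    (hy : HasSum (fun n => c n • P n) y) : HasSum (fun n => star (c n) • P n) (star y) := by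
  convert hy.star using 1
  funext n
  rw [star_smul, (hP.isStarProjection n).isSelfAdjoint.star_eq]

theorem coeff_tendsto_zero (hP : IsOrthogonalFamily P) (hc : IsCoeff P c) :
    Tendsto c atTop (𝓝 0) := by
  obtain ⟨C, hC⟩ := hc 1
  refine squeeze_zero_norm (fun n => ?_) (by simpa using hP.summable_inv.tendsto_atTop_zero.const_mul C)
  rw [← div_eq_mul_inv, le_div_iff₀ (zero_lt_one.trans_le (hP.one_le_opNorm n 1))]
  exact hC n

/-- The operators `∑ c_n P_n` form a closed set. -/
theorem hasSum_of_mem_closure (hP : IsOrthogonalFamily P) {y : SmoothOp}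
    (hy : y ∈ closure {z : SmoothOp | ∃ c : ℕ → ℂ, HasSum (fun n => c n • P n) z}) :
    ∃ c : ℕ → ℂ, HasSum (fun n => c n • P n) y := by
  -- Right multiplication by P_n maps all the sums into the line spanned by P_n. That line is
  -- closed, so y P_n lies in it as well, and this defines the coefficients of y.
  have hex : ∀ n, ∃ a : ℂ, y * P n = a • P n := by
    intro n
    have hcl : IsClosed ((ℂ ∙ P n : Submodule ℂ SmoothOp) : Set SmoothOp) :=
      Submodule.closed_of_finiteDimensional _
    have hmem : y * P n ∈ (ℂ ∙ P n : Submodule ℂ SmoothOp) := by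
      refine hcl.closure_subset_iff.2 ?_ (image_closure_subset_closure_image
        (continuous_id.mul continuous_const) (Set.mem_image_of_mem (fun z => z * P n) hy))
      rintro _ ⟨z, ⟨c, hc⟩, rfl⟩
      exact Submodule.mem_span_singleton.2 ⟨c n, (hP.mul_proj_of_hasSum hc n).symm⟩
    obtain ⟨a, ha⟩ := Submodule.mem_span_singleton.1 hmem
    exact ⟨a, ha.symm⟩
  choose c hc using hex
  obtain ⟨w, hw⟩ := hP.summable (hP.isCoeff_of_mul_proj hc)
  refine ⟨c, ?_⟩
  suffices h : y - w = 0 by rwa [sub_eq_zero.1 h]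
  -- The sum w of the series with the coefficients of y is compared with nearby sums z = ∑ d_n P_n:
  -- ‖z - w‖_q is controlled by the coefficients d_n - c_n, which are also those of z - y. This
  -- closed condition persists at z = y, where its right-hand side vanishes.
  set K : Set SmoothOp := {z | ∀ q, opNorm q (z - w) ≤
    opNorm (2 * (2 * max q 1)) (z - y) * const P} with hK
  have hcont : ∀ q (v : SmoothOp), Continuous fun z => opNorm q (z - v) := fun q v =>
    (withSeminorms.continuous_seminorm q).comp (continuous_id.sub continuous_const)
  have hKc : IsClosed K := by
    rw [hK, Set.ofPred_forall]
    exact isClosed_iInter fun q => isClosed_le (hcont q w) ((hcont _ y).mul continuous_const)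
  have hyK : y ∈ K := by
    refine closure_minimal ?_ hKc hy
    rintro z ⟨d, hd⟩ q
    have hsub : HasSum (fun n => (d n - c n) • P n) (z - w) := by
      simpa only [sub_smul] using hd.sub hw
    refine hP.opNorm_le_of_hasSum hsub fun n => ?_
    refine hP.norm_coeff_mul_opNorm_le ?_ _
    rw [sub_mul, hP.mul_proj_of_hasSum hd, hc, sub_smul]
  have h0 : ∀ q, norm q (y - w) = 0 := fun q =>
    le_antisymm (by simpa [← norm_apply] using hyK q) (apply_nonneg _ _)
  by_contra hne
  obtain ⟨q, hq⟩ := (withSeminorms.separating_iff_T1.2 inferInstance) _ hne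
  exact hq (h0 q)

end IsOrthogonalFamily

end SmoothOp

/-! ### Fréchet algebras defined by countably many seminorms -/

theorem IsFrechetAlgebra.of_withSeminorms {A : Type*} [NonUnitalRing A] [Module ℂ A]
    [IsScalarTower ℂ A A] [SMulCommClass ℂ A A] [TopologicalSpace A] [T2Space A] [ContinuousMul A]
    {p : SeminormFamily ℂ A ℕ} (hp : WithSeminorms p)
    (h : ∀ u : ℕ → A, (∀ q, ∀ ε > 0, ∃ N, ∀ m ≥ N, ∀ n ≥ N, p q (u m - u n) < ε) →
      ∃ a, Tendsto u atTop (𝓝 a)) : IsFrechetAlgebra A where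
  topologicalAddGroup := hp.topologicalAddGroup
  continuousSMul := hp.continuousSMul
  locallyConvex := hp.toLocallyConvexSpace
  metrizable := hp.metrizableSpace
  complete := have := hp.topologicalAddGroup; hp.completeSpace h
  continuousMul := inferInstance

theorem SmoothOp.isFrechetAlgebra_of_isClosed (S : NonUnitalStarSubalgebra ℂ SmoothOp)
    (hS : IsClosed (S : Set SmoothOp)) : IsFrechetAlgebra S := by
  refine IsFrechetAlgebra.of_withSeminorms
    ((NonUnitalStarSubalgebraClass.subtype S : S →ₗ[ℂ] SmoothOp).withSeminorms_induced
      SmoothOp.withSeminorms) fun u hu => ?_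
  obtain ⟨a, ha⟩ := SmoothOp.exists_tendsto_of_cauchy (fun n => (u n : SmoothOp)) hu
  have hmem : a ∈ S := hS.mem_of_tendsto ha (Eventually.of_forall fun n => (u n).2)
  exact ⟨⟨a, hmem⟩, tendsto_subtype_rng.2 ha⟩

/-! ### Spectrum and functional calculus of a spectral representation -/

namespace IsSpectralRepresentation

open SmoothOp

variable {x : SmoothOp} {lam : ℕ → ℂ} {P : ℕ → SmoothOp}

theorem isOrthogonalFamily (h : IsSpectralRepresentation x lam P) : IsOrthogonalFamily P :=
  ⟨h.isStarProjection, h.proj_ne_zero, h.orthogonal⟩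

theorem isCoeff (h : IsSpectralRepresentation x lam P) : IsCoeff P lam :=
  h.isOrthogonalFamily.isCoeff_of_mul_proj h.mul_proj

/-- The definition only asks for convergence of the ordered partial sums. Since x P_n = λ_n P_n, the
λ_n are admissible coefficients, and convergence is unconditional. -/
theorem hasSum (h : IsSpectralRepresentation x lam P) : HasSum (fun n => lam n • P n) x := by
  have hs := h.isOrthogonalFamily.summable h.isCoeff
  rw [← tendsto_nhds_unique hs.hasSum.tendsto_sum_nat h.tendsto]
  exact hs.hasSum

theorem tendsto_zero (h : IsSpectralRepresentation x lam P) : Tendsto lam atTop (𝓝 0) :=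
  h.isOrthogonalFamily.coeff_tendsto_zero h.isCoeff

/-- For any other z, the series ∑ λ_n (z - λ_n)⁻¹ P_n is an explicit quasi-inverse of -z⁻¹x. -/
theorem eq_zero_or_eq_of_mem_quasispectrum (h : IsSpectralRepresentation x lam P) {z : ℂ}
    (hz : z ∈ quasispectrum ℂ x) : z = 0 ∨ ∃ n, z = lam n := by
  by_contra! hcon
  obtain ⟨hz0, hzl⟩ := hcon
  have hP := h.isOrthogonalFamily
  have hne : ∀ n, z - lam n ≠ 0 := fun n => sub_ne_zero.2 (hzl n)
  have hlim : Tendsto (fun n => ‖(z - lam n)⁻¹‖) atTop (𝓝 ‖(z - 0)⁻¹‖) :=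
    ((h.tendsto_zero.const_sub z).inv₀ (by simpa using hz0)).norm
  obtain ⟨K, hK⟩ := hlim.bddAbove_range
  -- The factors (z - λ_n)⁻¹ converge to z⁻¹ and are therefore bounded, so they do not spoil the
  -- decay of λ_n.
  have hcoeff : IsCoeff P fun n => lam n * (z - lam n)⁻¹ := by
    intro q
    obtain ⟨C, hC⟩ := h.isCoeff q
    refine ⟨C * K, fun n => ?_⟩
    calc ‖lam n * (z - lam n)⁻¹‖ * opNorm q (P n)
        = (‖lam n‖ * opNorm q (P n)) * ‖(z - lam n)⁻¹‖ := by rw [norm_mul]; ring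
      _ ≤ C * K := by
        have h1 := hC n
        have h2 : ‖(z - lam n)⁻¹‖ ≤ K := hK ⟨n, rfl⟩
        have h3 : 0 ≤ ‖lam n‖ * opNorm q (P n) := mul_nonneg (norm_nonneg _) (opNorm_nonneg _ _)
        exact mul_le_mul h1 h2 (norm_nonneg _) (h3.trans h1)
  obtain ⟨y, hy⟩ := hP.summable hcoeff
  have hx : HasSum (fun n => (-(z⁻¹ * lam n)) • P n) (-(z⁻¹ • x)) := by
    have := (h.hasSum.const_smul z⁻¹).neg
    simpa only [smul_smul, neg_smul] using this
  have hunit : (IsUnit.mk0 z hz0).unit⁻¹ • x = z⁻¹ • x := by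
    rw [Units.smul_def, Units.val_inv_eq_inv_val, IsUnit.unit_spec]
  refine hz (IsUnit.mk0 z hz0) (isQuasiregular_iff.2 ⟨y, ?_, ?_⟩)
  · rw [hunit]
    refine ((hy.add hx).add (hP.hasSum_mul hx hy)).unique ?_
    convert hasSum_zero using 1
    funext n
    rw [← add_smul, ← add_smul]
    convert zero_smul ℂ (P n) using 2
    have := hne n
    field_simp
    ring
  · rw [hunit]
    refine ((hx.add hy).add (hP.hasSum_mul hy hx)).unique ?_
    convert hasSum_zero using 1
    funext n
    rw [← add_smul, ← add_smul]
    convert zero_smul ℂ (P n) using 2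
    have := hne n
    field_simp
    ring

/-- The sequence `(f(λ_n))` of a function `f ∈ C_s(σ(x))` has the required decay. -/
theorem isCoeff_point (h : IsSpectralRepresentation x lam P) (f : h.FunctionSpace) :
    IsCoeff P fun n => f (h.point n) := fun q => by
  obtain ⟨C, hC⟩ := FunctionSpace.bddAbove h f q
  exact ⟨C, fun n => hC ⟨n, rfl⟩⟩

theorem point_injective (h : IsSpectralRepresentation x lam P) : Function.Injective h.point :=
  fun _ _ hmn => h.lam_injective (congrArg Subtype.val hmn)

theorem functionSpace_ext (h : IsSpectralRepresentation x lam P) {f g : h.FunctionSpace}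
    (hfg : ∀ n, f (h.point n) = g (h.point n)) : f = g := by
  refine Subtype.ext (funext fun z => ?_)
  rcases h.eq_zero_or_eq_of_mem_quasispectrum z.2 with hz | ⟨n, hn⟩
  · have hz' : z = 0 := Subtype.ext hz
    rw [hz']
    exact (FunctionSpace.toFun_zero_point h f).trans (FunctionSpace.toFun_zero_point h g).symm
  · have hz' : z = h.point n := Subtype.ext hn
    rw [hz']
    exact hfg n

/-- Extension by zero off the λ_n; it is consistent because the λ_n are distinct, and it vanishes at
0 because they are nonzero. -/
theorem exists_functionSpace (h : IsSpectralRepresentation x lam P) {c : ℕ → ℂ}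
    (hc : IsCoeff P c) : ∃ f : h.FunctionSpace, ∀ n, f (h.point n) = c n := by
  have hpt : ∀ n, Function.extend h.point c 0 (h.point n) = c n := fun n =>
    h.point_injective.extend_apply c 0 n
  refine ⟨⟨Function.extend h.point c 0, ?_, fun q => ?_⟩, hpt⟩
  · refine Function.extend_apply' _ _ _ ?_
    rintro ⟨n, hn⟩
    exact h.lam_ne_zero n (congrArg Subtype.val hn)
  · obtain ⟨C, hC⟩ := hc q
    refine ⟨C, ?_⟩
    rintro _ ⟨n, rfl⟩
    dsimp only
    rw [hpt]
    exact hC n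

/-- The functional calculus `f ↦ f(x) = ∑ f(λ_n) P_n`. -/
noncomputable def functionalCalculus (h : IsSpectralRepresentation x lam P) :
    h.FunctionSpace →⋆ₙₐ[ℂ] SmoothOp :=
  have hs (f : h.FunctionSpace) : HasSum (fun n => f (h.point n) • P n) _ :=
    (h.isOrthogonalFamily.summable (h.isCoeff_point f)).hasSum
  { toFun := fun f => ∑' n, f (h.point n) • P n
    map_smul' := fun c f => by
      refine (hs (c • f)).unique ?_
      simp only [map_smul, Pi.smul_apply, smul_assoc]
      exact (hs f).const_smul c
    map_zero' := by simp
    map_add' := fun f g => by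
      refine (hs (f + g)).unique ?_
      simpa only [map_add, Pi.add_apply, add_smul] using (hs f).add (hs g)
    map_mul' := fun f g => by
      refine (hs (f * g)).unique ?_
      simpa only [map_mul, Pi.mul_apply] using h.isOrthogonalFamily.hasSum_mul (hs f) (hs g)
    map_star' := fun f => by
      refine (hs (star f)).unique ?_
      simpa only [map_star, Pi.star_apply] using h.isOrthogonalFamily.hasSum_star (hs f) }

variable (h : IsSpectralRepresentation x lam P)

theorem hasSum_functionalCalculus (f : h.FunctionSpace) :
    HasSum (fun n => f (h.point n) • P n) (h.functionalCalculus f) :=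
  (h.isOrthogonalFamily.summable (h.isCoeff_point f)).hasSum

theorem functionalCalculus_mul_proj (f : h.FunctionSpace) (n : ℕ) :
    h.functionalCalculus f * P n = f (h.point n) • P n :=
  h.isOrthogonalFamily.mul_proj_of_hasSum (h.hasSum_functionalCalculus f) n

theorem functionalCalculus_injective : Function.Injective h.functionalCalculus := by
  intro f g hfg
  refine h.functionSpace_ext fun n => smul_left_injective ℂ (h.proj_ne_zero n) ?_
  dsimp only
  rw [← functionalCalculus_mul_proj, ← functionalCalculus_mul_proj, hfg]

/-- Together with the next bound, this makes the seminorms c_q and the norms of f(x) equivalent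
families, up to a shift of the index. -/
theorem seminorm_le (q : ℕ) (f : h.FunctionSpace) :
    FunctionSpace.seminorm h q f ≤ opNorm (2 * q) (h.functionalCalculus f) :=
  ciSup_le fun n => h.isOrthogonalFamily.norm_coeff_mul_opNorm_le
    (h.functionalCalculus_mul_proj f n) q

theorem opNorm_functionalCalculus_le (q : ℕ) (f : h.FunctionSpace) :
    opNorm q (h.functionalCalculus f) ≤
      FunctionSpace.seminorm h (2 * max q 1) f * IsOrthogonalFamily.const P :=
  h.isOrthogonalFamily.opNorm_le_of_hasSum (h.hasSum_functionalCalculus f) fun n =>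
    le_ciSup (FunctionSpace.bddAbove h f (2 * max q 1)) n

theorem exists_functionalCalculus_eq_iff {y : SmoothOp} :
    (∃ f, h.functionalCalculus f = y) ↔ ∃ c : ℕ → ℂ, HasSum (fun n => c n • P n) y := by
  constructor
  · rintro ⟨f, rfl⟩
    exact ⟨_, h.hasSum_functionalCalculus f⟩
  · rintro ⟨c, hc⟩
    obtain ⟨f, hf⟩ := h.exists_functionSpace (h.isOrthogonalFamily.isCoeff_of_mul_proj
      (h.isOrthogonalFamily.mul_proj_of_hasSum hc))
    refine ⟨f, (h.hasSum_functionalCalculus f).unique ?_⟩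
    simpa only [hf] using hc

theorem isClosed_range_functionalCalculus : IsClosed (Set.range h.functionalCalculus) := by
  have heq : Set.range h.functionalCalculus =
      {z : SmoothOp | ∃ c : ℕ → ℂ, HasSum (fun n => c n • P n) z} :=
    Set.ext fun y => h.exists_functionalCalculus_eq_iff
  rw [heq]
  exact isClosed_of_closure_subset fun y hy => h.isOrthogonalFamily.hasSum_of_mem_closure hy

theorem exists_functionalCalculus_eq_self :
    ∃ f : h.FunctionSpace, (∀ n, f (h.point n) = lam n) ∧ h.functionalCalculus f = x := by
  obtain ⟨f, hf⟩ := h.exists_functionSpace h.isCoeff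
  refine ⟨f, hf, (h.hasSum_functionalCalculus f).unique ?_⟩
  simpa only [hf] using h.hasSum

/-- Lagrange interpolation by polynomials without constant term, since the algebra has no unit. -/
theorem exists_mem_alg_interpolating (h : IsSpectralRepresentation x lam P) (n : ℕ) (F : Finset ℕ) (hn : n ∉ F) :
    ∃ y ∈ x.alg, ∃ c : ℕ → ℂ, HasSum (fun k => c k • P k) y ∧ c n = 1 ∧ ∀ m ∈ F, c m = 0 := by
  have hx : x ∈ x.alg := NonUnitalStarAlgebra.elemental.self_mem ℂ x
  induction F using Finset.induction_on with
  | empty =>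
    refine ⟨(lam n)⁻¹ • x, SMulMemClass.smul_mem _ hx, fun k => (lam n)⁻¹ * lam k, ?_, ?_, by simp⟩
    · simpa only [smul_smul] using h.hasSum.const_smul (lam n)⁻¹
    · exact inv_mul_cancel₀ (h.lam_ne_zero n)
  | insert a F ha ih =>
    rw [Finset.mem_insert, not_or] at hn
    obtain ⟨y, hy, c, hc, hcn, hcF⟩ := ih hn.2
    have hne : (lam n - lam a) * lam n ≠ 0 :=
      mul_ne_zero (sub_ne_zero.2 (h.lam_injective.ne hn.1)) (h.lam_ne_zero n)
    -- The new factor t(t - λ_a) / (λ_n(λ_n - λ_a)), evaluated at x, has value 1 at λ_n and 0 at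
    -- λ_a.
    refine ⟨y * (((lam n - lam a) * lam n)⁻¹ • (x * x - lam a • x)),
      mul_mem hy (SMulMemClass.smul_mem _ (sub_mem (mul_mem hx hx) (SMulMemClass.smul_mem _ hx))),
      fun k => c k * (((lam n - lam a) * lam n)⁻¹ * (lam k * lam k - lam a * lam k)),
      h.isOrthogonalFamily.hasSum_mul hc ?_, ?_, ?_⟩
    · have h1 := ((h.isOrthogonalFamily.hasSum_mul h.hasSum h.hasSum).sub
        (h.hasSum.const_smul (lam a))).const_smul ((lam n - lam a) * lam n)⁻¹
      simpa only [smul_smul, ← sub_smul] using h1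
    · dsimp only
      rw [hcn, one_mul, ← sub_mul, inv_mul_cancel₀ hne]
    · intro m hm
      rcases Finset.mem_insert.1 hm with rfl | hm
      · simp
      · simp [hcF m hm]

/-- Only finitely many eigenvalues have modulus at least |λ_n|/2. An interpolating polynomial y in x
removes those other than λ_n, and multiplication by (x/λ_n)^k damps the rest by 2^{-k} while keeping
the coefficient 1 at λ_n. So y (x/λ_n)^k tends to P_n. -/
theorem proj_mem_alg (h : IsSpectralRepresentation x lam P) (n : ℕ) : P n ∈ x.alg := by
  have hP := h.isOrthogonalFamily
  have hx : x ∈ x.alg := NonUnitalStarAlgebra.elemental.self_mem ℂ x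
  have hpos : 0 < ‖lam n‖ / 2 := half_pos (norm_pos_iff.2 (h.lam_ne_zero n))
  obtain ⟨N, hN⟩ := eventually_atTop.1
    ((tendsto_zero_iff_norm_tendsto_zero.1 h.tendsto_zero).eventually_lt_const hpos)
  obtain ⟨y, hy, c, hc, hcn, hcF⟩ := h.exists_mem_alg_interpolating n
    ((Finset.range N).erase n) (Finset.notMem_erase n _)
  have hpow : ∀ k : ℕ, ∃ z ∈ x.alg,
      HasSum (fun m => (c m * ((lam n)⁻¹ * lam m) ^ k) • P m) z := by
    intro k
    induction k with
    | zero => exact ⟨y, hy, by simpa using hc⟩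
    | succ k ih =>
      obtain ⟨z, hz, hzs⟩ := ih
      refine ⟨z * ((lam n)⁻¹ • x), mul_mem hz (SMulMemClass.smul_mem _ hx), ?_⟩
      have h1 := hP.hasSum_mul hzs (d := fun m => (lam n)⁻¹ * lam m)
        (by simpa only [smul_smul] using h.hasSum.const_smul (lam n)⁻¹)
      simpa only [pow_succ, mul_assoc] using h1
  choose z hz hzs using hpow
  have hsingle : HasSum (fun m => (Pi.single n 1 : ℕ → ℂ) m • P m) (P n) := by
    convert hasSum_single n fun m hm => ?_ using 1
    · simp
    · rw [Pi.single_eq_of_ne hm, zero_smul]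
  refine (NonUnitalStarAlgebra.elemental.isClosed ℂ x).mem_of_tendsto (f := z) (b := atTop) ?_
    (Eventually.of_forall hz)
  rw [withSeminorms.tendsto_nhds]
  intro q ε hε
  obtain ⟨C, hC⟩ := hP.isCoeff_of_mul_proj (hP.mul_proj_of_hasSum hc) (2 * max q 1)
  -- Termwise: the coefficient at n cancels, those at the other m < N vanish, and those at m ≥ N are
  -- at most 2^{-k} times the coefficients of y.
  have hbound : ∀ k, opNorm q (z k - P n) ≤ C * (1 / 2) ^ k * IsOrthogonalFamily.const P := by
    intro k
    have hsub := (hzs k).sub hsingle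
    simp only [← sub_smul] at hsub
    have hC0 : 0 ≤ C := (mul_nonneg (norm_nonneg _) (opNorm_nonneg _ _)).trans (hC 0)
    refine hP.opNorm_le_of_hasSum hsub fun m => ?_
    by_cases hmn : m = n
    · subst hmn
      rw [hcn, inv_mul_cancel₀ (h.lam_ne_zero m), Pi.single_eq_same]
      simp only [one_pow, mul_one, sub_self, norm_zero, zero_mul]
      positivity
    rw [Pi.single_eq_of_ne hmn, sub_zero]
    by_cases hmN : m < N
    · rw [hcF m (Finset.mem_erase.2 ⟨hmn, Finset.mem_range.2 hmN⟩)]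
      simp only [zero_mul, norm_zero]
      positivity
    have h1 : ‖(lam n)⁻¹ * lam m‖ ≤ 1 / 2 := by
      rw [norm_mul, norm_inv, inv_mul_le_iff₀ (by linarith)]
      linarith [hN m (not_lt.1 hmN)]
    calc ‖c m * ((lam n)⁻¹ * lam m) ^ k‖ * opNorm (2 * max q 1) (P m)
        = (‖c m‖ * opNorm (2 * max q 1) (P m)) * ‖(lam n)⁻¹ * lam m‖ ^ k := by
          rw [norm_mul, norm_pow]; ring
      _ ≤ C * (1 / 2) ^ k :=
          mul_le_mul (hC m) (pow_le_pow_left₀ (norm_nonneg _) h1 k) (by positivity) hC0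
  have hlim : Tendsto (fun k : ℕ => C * (1 / 2 : ℝ) ^ k * IsOrthogonalFamily.const P) atTop
      (𝓝 (C * 0 * IsOrthogonalFamily.const P)) :=
    ((tendsto_pow_atTop_nhds_zero_of_lt_one (by norm_num) (by norm_num)).const_mul C).mul_const _
  rw [mul_zero, zero_mul] at hlim
  filter_upwards [hlim.eventually_lt_const hε] with k hk
  exact (hbound k).trans_lt hk

theorem functionalCalculus_mem_alg (f : h.FunctionSpace) : h.functionalCalculus f ∈ x.alg :=
  (NonUnitalStarAlgebra.elemental.isClosed ℂ x).mem_of_tendsto (h.hasSum_functionalCalculus f)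
    (Eventually.of_forall fun _ => sum_mem fun n _ => SMulMemClass.smul_mem _ (h.proj_mem_alg n))

theorem exists_functionalCalculus_eq_of_mem_alg {y : SmoothOp} (hy : y ∈ x.alg) :
    ∃ f, h.functionalCalculus f = y := by
  have hle : x.alg ≤ NonUnitalStarAlgHom.range h.functionalCalculus := by
    refine NonUnitalStarAlgebra.elemental.le_of_mem ?_ ?_
    · simpa using h.isClosed_range_functionalCalculus
    · obtain ⟨f, -, hf⟩ := h.exists_functionalCalculus_eq_self
      exact ⟨f, hf⟩
  exact hle hy

/-- The functional calculus as an isomorphism onto `alg(x)`. -/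
noncomputable def functionalCalculusEquiv : h.FunctionSpace ≃⋆ₐ[ℂ] x.alg :=
  StarAlgEquiv.ofBijective
    (NonUnitalStarAlgHom.codRestrict h.functionalCalculus x.alg h.functionalCalculus_mem_alg)
    ⟨fun _ _ hfg => h.functionalCalculus_injective (congrArg Subtype.val hfg), fun y => by
      obtain ⟨f, hf⟩ := h.exists_functionalCalculus_eq_of_mem_alg y.2
      exact ⟨f, Subtype.ext hf⟩⟩

theorem coe_functionalCalculusEquiv (f : h.FunctionSpace) :
    (h.functionalCalculusEquiv f : SmoothOp) = h.functionalCalculus f := rfl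

theorem continuous_functionalCalculus : Continuous h.functionalCalculus := by
  refine WithSeminorms.continuous_of_isBounded (FunctionSpace.withSeminorms h) withSeminorms
    (h.functionalCalculus : h.FunctionSpace →ₗ[ℂ] SmoothOp) fun q => ?_
  refine ⟨{2 * max q 1}, ⟨_, IsOrthogonalFamily.const_nonneg P⟩, fun f => ?_⟩
  rw [Finset.sup_singleton]
  refine (h.opNorm_functionalCalculus_le q f).trans (le_of_eq ?_)
  rw [mul_comm]
  rfl

theorem isInducing_functionalCalculus : Topology.IsInducing h.functionalCalculus := by
  have h1 := (h.functionalCalculus : h.FunctionSpace →ₗ[ℂ] SmoothOp).withSeminorms_induced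
    withSeminorms
  refine ⟨le_antisymm h.continuous_functionalCalculus.le_induced ?_⟩
  refine continuous_id_iff_le.1 ?_
  refine WithSeminorms.continuous_of_isBounded h1 (FunctionSpace.withSeminorms h)
    LinearMap.id fun q => ?_
  refine ⟨{2 * q}, 1, fun f => ?_⟩
  rw [Finset.sup_singleton, one_smul]
  exact h.seminorm_le q f

theorem continuous_functionalCalculusEquiv : Continuous h.functionalCalculusEquiv :=
  h.continuous_functionalCalculus.subtype_mk _

theorem continuous_functionalCalculusEquiv_symm : Continuous h.functionalCalculusEquiv.symm := by
  rw [h.isInducing_functionalCalculus.continuous_iff]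
  convert continuous_subtype_val using 1
  funext y
  rw [Function.comp_apply, ← coe_functionalCalculusEquiv]
  exact congrArg Subtype.val (h.functionalCalculusEquiv.apply_symm_apply y)

/-- The functional calculus is an embedding with closed range, so separation, continuity of the
product and completeness are inherited from L(s', s). -/
theorem isFrechetAlgebra_functionSpace : IsFrechetAlgebra h.FunctionSpace := by
  have hind := h.isInducing_functionalCalculus
  have : T2Space h.FunctionSpace :=
    (Topology.IsEmbedding.mk hind h.functionalCalculus_injective).t2Space
  have : ContinuousMul h.FunctionSpace := hind.continuousMul h.functionalCalculus
  have h1 := Topology.IsInducing.withSeminorms withSeminorms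
    (f := (h.functionalCalculus : h.FunctionSpace →ₗ[ℂ] SmoothOp)) hind
  refine IsFrechetAlgebra.of_withSeminorms h1 fun u hu => ?_
  obtain ⟨a, ha⟩ := exists_tendsto_of_cauchy (fun n => h.functionalCalculus (u n)) fun q ε hε => by
    simp only [← map_sub]
    exact hu q ε hε
  obtain ⟨f, rfl⟩ := h.isClosed_range_functionalCalculus.mem_of_tendsto ha
    (Eventually.of_forall fun n => ⟨u n, rfl⟩)
  exact ⟨f, hind.tendsto_nhds_iff.2 ha⟩

end IsSpectralRepresentation

/-! ### Compact normal operators on Hilbert spaces -/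

section CompactNormal

open Module.End ContinuousLinearMap

variable {E : Type*} [NormedAddCommGroup E] [InnerProductSpace ℂ E] [CompleteSpace E]
  {T : E →L[ℂ] E}

/-- T - μ is normal, and a normal operator has the same kernel as its adjoint. -/
theorem IsStarNormal.adjoint_apply_of_apply_eq_smul (hT : IsStarNormal T) {v : E} {μ : ℂ}
    (hv : T v = μ • v) : adjoint T v = star μ • v := by
  have hN : IsStarNormal (T - μ • ContinuousLinearMap.id ℂ E) := by
    refine ⟨?_⟩
    have h1 : star (T - μ • ContinuousLinearMap.id ℂ E)
        = star T - star μ • ContinuousLinearMap.id ℂ E := by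
      rw [star_sub, star_smul]
      congr 2
      exact star_one _
    rw [h1]
    have hc : Commute (star T) T := hT.star_comm_self
    have hi : ∀ (c : ℂ) (S : E →L[ℂ] E), Commute (c • ContinuousLinearMap.id ℂ E) S :=
      fun c S => (Commute.one_left S).smul_left c
    exact (hc.sub_right (hi _ _).symm).sub_left ((hi _ _))
  have h0 : (T - μ • ContinuousLinearMap.id ℂ E) v = 0 := by simp [hv]
  have h1 := (hN.adjoint_apply_eq_zero_iff v).2 h0
  rw [map_sub, map_smulₛₗ, adjoint_id] at h1
  simpa [sub_eq_zero] using h1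

theorem IsStarNormal.isOrtho_eigenspace (hT : IsStarNormal T) {μ ν : ℂ} (h : μ ≠ ν) :
    eigenspace (T : Module.End ℂ E) μ ⟂ eigenspace (T : Module.End ℂ E) ν := by
  rw [Submodule.isOrtho_iff_inner_eq]
  intro v hv w hw
  have hv' : T v = μ • v := mem_eigenspace_iff.1 hv
  have hw' : T w = ν • w := mem_eigenspace_iff.1 hw
  have h1 := adjoint_inner_left T w v
  rw [hT.adjoint_apply_of_apply_eq_smul hv', hw', inner_smul_left, inner_smul_right] at h1
  simp only [Complex.star_def, Complex.conj_conj] at h1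
  exact (mul_eq_mul_right_iff.1 h1).resolve_left h

/-- The norm of a normal operator is its spectral radius, and nonzero spectral values of a compact
operator are eigenvalues. -/
theorem IsStarNormal.eq_zero_of_isCompactOperator (hT : IsStarNormal T)
    (hc : IsCompactOperator T) (h : ∀ μ, HasEigenvalue (T : Module.End ℂ E) μ → μ = 0) :
    T = 0 := by
  rw [← nnnorm_eq_zero, ← ENNReal.coe_eq_zero, ← IsStarNormal.spectralRadius_eq_nnnorm T,
    spectralRadius, ENNReal.iSup_eq_zero]
  intro μ
  rw [ENNReal.iSup_eq_zero]
  intro hμ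
  by_contra hne
  have hμ0 : μ ≠ 0 := fun h0 => hne (by simp [h0])
  exact hμ0 (h μ ((hc.hasEigenvalue_iff_mem_spectrum hμ0).2 hμ))

/-- The spectral theorem for compact normal operators. -/
theorem IsStarNormal.orthogonal_iSup_eigenspace_eq_bot (hT : IsStarNormal T)
    (hc : IsCompactOperator T) : (⨆ μ, eigenspace (T : Module.End ℂ E) μ)ᗮ = ⊥ := by
  set V : Submodule ℂ E := ⨆ μ, eigenspace (T : Module.End ℂ E) μ with hV
  have hmem : ∀ v : E, v ∈ Vᗮ ↔ ∀ μ : ℂ, ∀ w : E, T w = μ • w → inner ℂ w v = 0 := by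
    intro v
    rw [hV, ← Submodule.iInf_orthogonal, Submodule.mem_iInf]
    simp only [Submodule.mem_orthogonal, mem_eigenspace_iff]
    rfl
  have hTV : ∀ v ∈ Vᗮ, T v ∈ Vᗮ := by
    intro v hv
    rw [hmem] at hv ⊢
    intro μ w hw
    rw [← adjoint_inner_left, hT.adjoint_apply_of_apply_eq_smul hw, inner_smul_left, hv μ w hw,
      mul_zero]
  have hTV' : ∀ v ∈ Vᗮ, adjoint T v ∈ Vᗮ := by
    intro v hv
    rw [hmem] at hv ⊢
    intro μ w hw
    rw [adjoint_inner_right, hw, inner_smul_left, hv μ w hw, mul_zero]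
  -- The complement is invariant under T and T*, so the restriction S is again compact and normal.
  set S : Vᗮ →L[ℂ] Vᗮ := T.restrict hTV with hS
  have hSadj : (adjoint T).restrict hTV' = adjoint S := by
    rw [ContinuousLinearMap.eq_adjoint_iff]
    intro v w
    exact adjoint_inner_left T (w : E) (v : E)
  have hSn : IsStarNormal S := by
    rw [isStarNormal_iff_norm_eq_adjoint]
    intro v
    rw [← hSadj]
    exact isStarNormal_iff_norm_eq_adjoint.1 hT (v : E)
  have hSc : IsCompactOperator S := hc.restrict' hTV
  -- An eigenvector of S is one of T, so it lies in V as well as in its complement. Hence S has no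
  -- eigenvalue and vanishes, and then every vector of the complement is an eigenvector for 0.
  have hno : ∀ (μ : ℂ) (v : Vᗮ), S v = μ • v → v = 0 := by
    intro μ v hv
    have h1 : T (v : E) = μ • (v : E) := congrArg Subtype.val hv
    exact Subtype.ext (inner_self_eq_zero.1 ((hmem v).1 v.2 μ v h1))
  have hS0 : S = 0 := hSn.eq_zero_of_isCompactOperator hSc fun μ hμ => by
    obtain ⟨v, hv⟩ := hμ.exists_hasEigenvector
    exact absurd (hno μ v hv.apply_eq_smul) hv.2
  rw [Submodule.eq_bot_iff]
  intro v hv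
  have := hno 0 ⟨v, hv⟩ (by rw [hS0]; simp)
  exact congrArg Subtype.val this

/-- Two bounded operators that agree on the eigenvectors of a compact normal operator are equal. -/
theorem IsStarNormal.eq_of_eqOn_eigenvectors (hT : IsStarNormal T) (hc : IsCompactOperator T)
    {A B : E →L[ℂ] E} (h : ∀ (μ : ℂ) (v : E), T v = μ • v → A v = B v) : A = B := by
  refine ContinuousLinearMap.ext_on ((Submodule.topologicalClosure_eq_top_iff).2
    (hT.orthogonal_iSup_eigenspace_eq_bot hc) |> Submodule.dense_iff_topologicalClosure_eq_top.2
    |> fun hd => ?_) (s := ((⨆ μ, eigenspace (T : Module.End ℂ E) μ : Submodule ℂ E) : Set E)) ?_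
  · rwa [Submodule.span_eq]
  · have hle : (⨆ μ, eigenspace (T : Module.End ℂ E) μ) ≤ LinearMap.eqLocus A.toLinearMap B.toLinearMap :=
      iSup_le fun μ v hv => h μ v (mem_eigenspace_iff.1 hv)
    exact fun v hv => hle hv

/-- The orthogonal projection onto an eigenspace absorbs `T` from both sides. -/
theorem IsStarNormal.mul_starProjection_eigenspace (hT : IsStarNormal T) (μ : ℂ)
    [(eigenspace (T : Module.End ℂ E) μ).HasOrthogonalProjection] :
    T * (eigenspace (T : Module.End ℂ E) μ).starProjection
        = μ • (eigenspace (T : Module.End ℂ E) μ).starProjection ∧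
      (eigenspace (T : Module.End ℂ E) μ).starProjection * T
        = μ • (eigenspace (T : Module.End ℂ E) μ).starProjection := by
  set p := (eigenspace (T : Module.End ℂ E) μ).starProjection with hp
  have hmem : ∀ v, T (p v) = μ • p v := fun v =>
    mem_eigenspace_iff.1 (Submodule.starProjection_apply_mem _ v)
  have hps : star p = p := isStarProjection_starProjection.isSelfAdjoint
  refine ⟨ContinuousLinearMap.ext hmem, ?_⟩
  have h1 : star T * p = star μ • p :=
    ContinuousLinearMap.ext fun v => hT.adjoint_apply_of_apply_eq_smul (hmem v)
  have h2 := congrArg star h1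
  rwa [star_mul, star_star, hps, star_smul, star_star, hps] at h2

end CompactNormal

/-- A positive family on an infinite index set that has only finitely many members above any
positive number can be enumerated in decreasing order. -/
theorem exists_equiv_antitone {ι : Type*} [Infinite ι] {a : ι → ℝ} (h0 : ∀ i, 0 < a i)
    (hfin : ∀ ε > 0, {i | ε ≤ a i}.Finite) : ∃ e : ℕ ≃ ι, Antitone (a ∘ e) := by
  classical
  -- Greedy enumeration: outside each finite set the family attains its maximum, because only
  -- finitely many members exceed a given one.
  have hstep : ∀ F : Finset ι, ∃ i ∉ F, ∀ j ∉ F, a j ≤ a i := by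
    intro F
    obtain ⟨j₀, hj₀⟩ := Infinite.exists_notMem_finset F
    obtain ⟨i, hi, hmax⟩ := ((hfin (a j₀) (h0 j₀)).subset Set.sdiff_subset).exists_maximalFor a
      ({i | a j₀ ≤ a i} \ F) ⟨j₀, le_refl (a j₀), hj₀⟩
    refine ⟨i, hi.2, fun j hj => ?_⟩
    rcases le_total (a j) (a i) with hle | hle
    · exact hle
    · exact hmax ⟨le_trans hi.1 hle, hj⟩ hle
  choose c hc hmax using hstep
  let F : ℕ → Finset ι := fun n => Nat.rec ∅ (fun _ s => insert (c s) s) n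
  have hF : ∀ n, F (n + 1) = insert (c (F n)) (F n) := fun _ => rfl
  have hmono : Monotone F := monotone_nat_of_le_succ fun n => by
    rw [hF]; exact Finset.subset_insert _ _
  have hmem : ∀ {m n}, m < n → c (F m) ∈ F n := fun {m n} hmn =>
    hmono (Nat.succ_le_of_lt hmn) (by rw [hF]; exact Finset.mem_insert_self _ _)
  have hinj : Function.Injective fun n => c (F n) := by
    intro m n (hmn : c (F m) = c (F n))
    by_contra hne
    rcases lt_or_gt_of_ne hne with h | h
    · exact hc (F n) (hmn ▸ hmem h)
    · exact hc (F m) (hmn.symm ▸ hmem h)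
  have hFc : ∀ {i : ι} {n}, i ∈ F n → ∃ m, c (F m) = i := by
    intro i n
    induction n with
    | zero => exact fun hi => absurd hi (Finset.notMem_empty i)
    | succ n ih =>
      rw [hF, Finset.mem_insert]
      rintro (hi | hi)
      · exact ⟨n, hi.symm⟩
      · exact ih hi
  -- A member never chosen would lie below the infinitely many chosen ones, contradicting
  -- finiteness.
  have hsurj : Function.Surjective fun n => c (F n) := by
    intro i
    by_contra hcon
    have hi : ∀ n, i ∉ F n := fun n hn => hcon (hFc hn)
    exact Set.infinite_of_injective_forall_mem hinj (fun n => hmax (F n) i (hi n))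
      (hfin (a i) (h0 i))
  refine ⟨Equiv.ofBijective _ ⟨hinj, hsurj⟩, antitone_nat_of_succ_le fun n => ?_⟩
  exact hmax (F n) _ fun h => hc (F (n + 1)) (hmono n.le_succ h)

/-! ### Smooth operators as operators on `ℓ²` -/

/-- The Hilbert space `ℓ²`. -/
abbrev L2Seq : Type := lp (fun _ : ℕ => ℂ) 2

theorem wSummable_zero_coe (u : L2Seq) : WSummable 0 (u : ℕ → ℂ) := by
  rw [← memlp_wseq]
  convert lp.memℓp u using 1
  funext j
  simp [wseq]

/-- The inclusion of `ℓ²` into `s'`. -/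
noncomputable def l2ToSlow : L2Seq →ₗ[ℂ] SlowSeq where
  toFun u := SlowSeq.mk u ⟨0, by simpa using wSummable_zero_coe u⟩
  map_add' _ _ := rfl
  map_smul' _ _ := rfl

theorem coords_l2ToSlow (u : L2Seq) : (l2ToSlow u).coords = u := rfl

theorem wSummable_l2ToSlow (u : L2Seq) : WSummable 0 (l2ToSlow u).coords := wSummable_zero_coe u

theorem wnorm_l2ToSlow (u : L2Seq) : wnorm 0 (l2ToSlow u).coords = ‖u‖ := by
  rw [← norm_wl2 (wSummable_l2ToSlow u)]
  congr 1
  refine Subtype.ext (funext fun j => ?_)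
  change wseq 0 u j = u j
  simp [wseq]

theorem l2ToSlow_toL2 (ξ : RapidSeq) : l2ToSlow ξ.toL2 = rapidToSlow ξ :=
  SlowSeq.ext (funext fun j => ξ.toL2_apply j)

/-- The inclusion of `s` into `ℓ²` as a linear map. -/
noncomputable def RapidSeq.toL2Lin : RapidSeq →ₗ[ℂ] L2Seq where
  toFun := RapidSeq.toL2
  map_add' ξ η := lp.ext (funext fun j => by simp [RapidSeq.toL2_apply])
  map_smul' c ξ := lp.ext (funext fun j => by simp [RapidSeq.toL2_apply])

theorem RapidSeq.toL2_injective : Function.Injective RapidSeq.toL2 := fun ξ η h =>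
  RapidSeq.ext (funext fun j => by rw [← ξ.toL2_apply, h, η.toL2_apply])

theorem inner_l2_toL2 (v : L2Seq) (ξ : RapidSeq) :
    inner ℂ v ξ.toL2 = pairing ξ (l2ToSlow v) := by
  rw [lp.inner_eq_tsum]
  refine tsum_congr fun j => ?_
  simp [RapidSeq.toL2_apply, coords_l2ToSlow]

namespace SmoothOp

/-- The operator on `ℓ²` induced by `x : s' → s`. -/
noncomputable def toL2CLM (x : SmoothOp) : L2Seq →L[ℂ] L2Seq :=
  (RapidSeq.toL2Lin ∘ₗ (x : SlowSeq →L[ℂ] RapidSeq).toLinearMap ∘ₗ l2ToSlow).mkContinuous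
    (opNorm 0 x) fun u => by
      have h := le_opNorm 0 x (ξ := l2ToSlow u) (by simpa using wSummable_l2ToSlow u)
      simp only [Nat.cast_zero, neg_zero] at h
      rw [wnorm_l2ToSlow, ← RapidSeq.norm_toL2] at h
      exact h

theorem toL2CLM_apply (x : SmoothOp) (u : L2Seq) : toL2CLM x u = (x (l2ToSlow u)).toL2 := rfl

theorem norm_toL2CLM_le (x : SmoothOp) : ‖toL2CLM x‖ ≤ opNorm 0 x :=
  LinearMap.mkContinuous_norm_le _ (opNorm_nonneg _ _) _

/-- The representation of `L(s', s)` on `ℓ²`. -/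
noncomputable def toL2Hom : SmoothOp →⋆ₙₐ[ℂ] (L2Seq →L[ℂ] L2Seq) where
  toFun := toL2CLM
  map_smul' c x := ContinuousLinearMap.ext fun u => RapidSeq.toL2Lin.map_smul c (x (l2ToSlow u))
  map_zero' := ContinuousLinearMap.ext fun _ => RapidSeq.toL2Lin.map_zero
  map_add' x y := ContinuousLinearMap.ext fun u =>
    RapidSeq.toL2Lin.map_add (x (l2ToSlow u)) (y (l2ToSlow u))
  map_mul' x y := ContinuousLinearMap.ext fun u => by
    rw [mul_apply_eq_comp, toL2CLM_apply, toL2CLM_apply, toL2CLM_apply, l2ToSlow_toL2,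
      mul_apply]
  map_star' x := by
    rw [ContinuousLinearMap.star_eq_adjoint, ContinuousLinearMap.eq_adjoint_iff]
    intro u v
    rw [toL2CLM_apply, toL2CLM_apply, inner_l2_toL2, pairing_star, ← inner_l2_toL2]
    exact (inner_conj_symm _ _).symm

theorem toL2Hom_apply (x : SmoothOp) (u : L2Seq) : toL2Hom x u = (x (l2ToSlow u)).toL2 := rfl

theorem l2ToSlow_single (j : ℕ) : l2ToSlow (lp.single 2 j 1) = SlowSeq.single j := rfl

/-- The expansion ξ = ∑ ξ_j e_j converges in s', so an operator is determined by the values x e_j.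
Hence nothing is lost in passing to ℓ². -/
theorem ext_single {x y : SmoothOp} (h : ∀ j, x (SlowSeq.single j) = y (SlowSeq.single j)) :
    x = y := by
  refine ext fun ξ => RapidSeq.ext (funext fun k => ?_)
  have h1 := hasSum_apply x ξ (pairingCLM (SlowSeq.single k))
  have h2 := hasSum_apply y ξ (pairingCLM (SlowSeq.single k))
  simp only [h] at h1
  have h3 := h1.unique h2
  rwa [pairingCLM_apply, pairingCLM_apply, pairing_single, pairing_single] at h3

theorem toL2Hom_injective : Function.Injective toL2Hom := fun x y h =>
  ext_single fun j => RapidSeq.toL2_injective <| by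
    rw [← l2ToSlow_single, ← toL2Hom_apply, h, toL2Hom_apply]

theorem continuous_toL2Hom : Continuous toL2Hom := by
  refine WithSeminorms.continuous_normedSpace_rng (L2Seq →L[ℂ] L2Seq) withSeminorms
    (toL2Hom : SmoothOp →ₗ[ℂ] (L2Seq →L[ℂ] L2Seq)) ⟨{0}, 1, fun x => ?_⟩
  rw [Finset.sup_singleton, one_smul]
  exact norm_toL2CLM_le x

/-- The operator is the norm-convergent sum of the rank-one maps u ↦ u_j x e_j, whose norms are at
most ‖x‖_2 (j + 1)^{-2}. -/
theorem isCompactOperator_toL2Hom (x : SmoothOp) : IsCompactOperator (toL2Hom x) := by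
  let R : ℕ → L2Seq →L[ℂ] L2Seq := fun j =>
    (ContinuousLinearMap.toSpanSingleton ℂ (x (SlowSeq.single j)).toL2).comp
      (lp.evalCLM ℂ (fun _ : ℕ => ℂ) (p := 2) j)
  have hRapply : ∀ j u, R j u = u j • (x (SlowSeq.single j)).toL2 := fun _ _ => rfl
  have hRc : ∀ j, IsCompactOperator (R j) := fun j =>
    (isCompactOperator_of_locallyCompactSpace_rng
      (ContinuousLinearMap.toSpanSingleton ℂ (x (SlowSeq.single j)).toL2)).comp_clm _
  have hRn : ∀ j, ‖R j‖ ≤ opNorm 2 x * ((j : ℝ) + 1) ^ (-2 : ℤ) := by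
    intro j
    refine ContinuousLinearMap.opNorm_le_bound _
      (mul_nonneg (opNorm_nonneg _ _) (by positivity)) fun u => ?_
    rw [hRapply, norm_smul, mul_comm]
    refine mul_le_mul ?_ (lp.norm_apply_le_norm (by norm_num) u j) (norm_nonneg _)
      (mul_nonneg (opNorm_nonneg _ _) (by positivity))
    have h := le_opNorm 2 x (SlowSeq.single_wSummable (-(2 : ℕ)) j)
    rw [SlowSeq.single_wnorm] at h
    rw [RapidSeq.norm_toL2]
    exact (wnorm_mono (by norm_num) ((x (SlowSeq.single j)).wSummable _)).trans h
  have hsum : Summable R :=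
    Summable.of_norm_bounded (summable_weight_neg_two.mul_left (opNorm 2 x)) hRn
  have hR : HasSum R (toL2Hom x) := by
    convert hsum.hasSum using 1
    refine ContinuousLinearMap.ext fun u => lp.ext (funext fun k => ?_)
    have h1 : HasSum (fun j => R j u k) ((∑' j, R j) u k) :=
      (hsum.hasSum.mapL (ContinuousLinearMap.apply ℂ L2Seq u)).mapL
        (lp.evalCLM ℂ (fun _ : ℕ => ℂ) (p := 2) k)
    refine HasSum.unique ?_ h1
    have h2 := hasSum_apply x (l2ToSlow u) (pairingCLM (SlowSeq.single k))
    simp only [pairingCLM_apply, pairing_single] at h2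
    rw [toL2Hom_apply, RapidSeq.toL2_apply]
    convert h2 using 1
    funext j
    rw [hRapply]
    simp [RapidSeq.toL2_apply, coords_l2ToSlow]
  refine isCompactOperator_of_tendsto (l := atTop) hR (Eventually.of_forall fun s => ?_)
  exact (compactOperator (RingHom.id ℂ) L2Seq L2Seq).sum_mem fun j _ => hRc j

theorem wnorm_zero_le_opNorm (B : L2Seq →L[ℂ] L2Seq) (ξ : RapidSeq) :
    wnorm 0 (l2ToSlow (B ξ.toL2)).coords ≤ ‖B‖ * wnorm 0 ξ.coords := by
  rw [wnorm_l2ToSlow, ← RapidSeq.norm_toL2]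
  exact B.le_opNorm _

/-- `x B x ∈ L(s', s)` for a bounded operator `B` on `ℓ²`. -/
noncomputable def sandwich (x : SmoothOp) (B : L2Seq →L[ℂ] L2Seq) : SmoothOp :=
  ofBound ((x : SlowSeq →L[ℂ] RapidSeq).toLinearMap ∘ₗ l2ToSlow ∘ₗ B.toLinearMap ∘ₗ
    RapidSeq.toL2Lin ∘ₗ (x : SlowSeq →L[ℂ] RapidSeq).toLinearMap) fun q k => by
      obtain ⟨C, hC0, hC⟩ := exists_bound x q 0
      obtain ⟨D, hD0, hD⟩ := exists_bound x 0 k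
      simp only [Nat.cast_zero, neg_zero] at hC hD
      refine ⟨C * (‖B‖ * D), fun ξ hξ => ?_⟩
      calc _ ≤ C * wnorm 0 (l2ToSlow (B (x ξ).toL2)).coords := hC _ (wSummable_l2ToSlow _)
        _ ≤ C * (‖B‖ * wnorm 0 (x ξ).coords) :=
            mul_le_mul_of_nonneg_left (wnorm_zero_le_opNorm B (x ξ)) hC0
        _ ≤ C * (‖B‖ * (D * wnorm (-(k : ℤ)) ξ.coords)) := by
            gcongr
            exact hD ξ hξ
        _ = _ := by ring

theorem toL2Hom_sandwich (x : SmoothOp) (B : L2Seq →L[ℂ] L2Seq) :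
    toL2Hom (sandwich x B) = toL2Hom x * B * toL2Hom x := rfl

/-! ### The spectral representation of a normal operator -/

open Module.End

variable {x : SmoothOp}

theorem isStarNormal_toL2Hom (hx : IsStarNormal x) : IsStarNormal (toL2Hom x) := hx.map toL2Hom

/-- The nonzero eigenvalues of `x`. -/
abbrev Eigenvalue (x : SmoothOp) : Type :=
  {μ : ℂ // μ ≠ 0 ∧ HasEigenvalue (toL2Hom x : Module.End ℂ L2Seq) μ}

/-- The eigenspace of `x` in `ℓ²` for a nonzero eigenvalue. -/
noncomputable abbrev eigenspaceL2 (x : SmoothOp) (μ : Eigenvalue x) : Submodule ℂ L2Seq :=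
  eigenspace (toL2Hom x : Module.End ℂ L2Seq) μ.1

instance (μ : Eigenvalue x) : FiniteDimensional ℂ (eigenspaceL2 x μ) :=
  ContinuousLinearMap.finite_dimensional_eigenspace (isCompactOperator_toL2Hom x) μ.1 μ.2.1

/-- The spectral projection of `x` for a nonzero eigenvalue. -/
noncomputable def spectralProj (μ : Eigenvalue x) : SmoothOp :=
  (μ.1⁻¹ * μ.1⁻¹) • sandwich x (eigenspaceL2 x μ).starProjection

/-- On the eigenspace T E = E T = μE, so T E T = μ² E. The outer factors x make E a map from s' to
s. -/
theorem toL2Hom_spectralProj (hx : IsStarNormal x) (μ : Eigenvalue x) :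
    toL2Hom (spectralProj μ) = (eigenspaceL2 x μ).starProjection := by
  obtain ⟨h1, h2⟩ := (isStarNormal_toL2Hom hx).mul_starProjection_eigenspace μ.1
  rw [spectralProj, map_smul, toL2Hom_sandwich, h1, smul_mul_assoc, h2, smul_smul, smul_smul]
  have : μ.1⁻¹ * μ.1⁻¹ * μ.1 * μ.1 = 1 := by
    have := μ.2.1
    field_simp
  rw [this, one_smul]

theorem isStarProjection_spectralProj (hx : IsStarNormal x) (μ : Eigenvalue x) :
    IsStarProjection (spectralProj μ) := by
  have h : IsStarProjection (eigenspaceL2 x μ).starProjection := isStarProjection_starProjection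
  constructor
  · refine toL2Hom_injective ?_
    rw [map_mul, toL2Hom_spectralProj hx, h.isIdempotentElem.eq]
  · refine toL2Hom_injective ?_
    rw [map_star, toL2Hom_spectralProj hx, h.isSelfAdjoint.star_eq]

theorem spectralProj_ne_zero (hx : IsStarNormal x) (μ : Eigenvalue x) : spectralProj μ ≠ 0 := by
  intro h0
  obtain ⟨v, hv⟩ := μ.2.2.exists_hasEigenvector
  have h1 := toL2Hom_spectralProj hx μ
  rw [h0, map_zero] at h1
  have h2 : (eigenspaceL2 x μ).starProjection v = v :=
    Submodule.starProjection_eq_self_iff.2 hv.1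
  rw [← h1] at h2
  exact hv.2 h2.symm

theorem spectralProj_mul_spectralProj (hx : IsStarNormal x) {μ ν : Eigenvalue x} (h : μ ≠ ν) :
    spectralProj μ * spectralProj ν = 0 := by
  refine toL2Hom_injective ?_
  rw [map_mul, map_zero, toL2Hom_spectralProj hx, toL2Hom_spectralProj hx]
  exact Submodule.starProjection_comp_starProjection_eq_zero_iff.2
    ((isStarNormal_toL2Hom hx).isOrtho_eigenspace fun h' => h (Subtype.ext h'))

theorem mul_spectralProj (hx : IsStarNormal x) (μ : Eigenvalue x) :
    x * spectralProj μ = μ.1 • spectralProj μ := by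
  refine toL2Hom_injective ?_
  rw [map_mul, map_smul, toL2Hom_spectralProj hx]
  exact ((isStarNormal_toL2Hom hx).mul_starProjection_eigenspace μ.1).1

theorem finiteDimensional_range_spectralProj (hx : IsStarNormal x) (μ : Eigenvalue x) :
    FiniteDimensional ℂ (LinearMap.range (spectralProj μ : SlowSeq →ₗ[ℂ] RapidSeq)) := by
  have hmem : ∀ η : LinearMap.range (spectralProj μ : SlowSeq →ₗ[ℂ] RapidSeq),
      RapidSeq.toL2Lin (η : RapidSeq) ∈ eigenspaceL2 x μ := by
    rintro ⟨_, ξ, rfl⟩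
    rw [mem_eigenspace_iff]
    change (x (l2ToSlow (spectralProj μ ξ).toL2)).toL2 = μ.1 • RapidSeq.toL2Lin (spectralProj μ ξ)
    rw [l2ToSlow_toL2, ← mul_apply, mul_spectralProj hx, smul_apply]
    exact RapidSeq.toL2Lin.map_smul _ _
  refine FiniteDimensional.of_injective (LinearMap.codRestrict (eigenspaceL2 x μ)
    (RapidSeq.toL2Lin ∘ₗ Submodule.subtype _) hmem) fun η η' h => ?_
  exact Subtype.ext (RapidSeq.toL2_injective (congrArg Subtype.val h))

/-- Here |μ| ≤ ‖x‖_2 / ‖P_μ‖_1, and the right-hand sides are summable over all nonzero eigenvalues.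
-/
theorem finite_eigenvalue_norm_ge (hx : IsStarNormal x) {ε : ℝ} (hε : 0 < ε) :
    {μ : Eigenvalue x | ε ≤ ‖μ.1‖}.Finite := by
  have hs := (summable_inv_opNorm (isStarProjection_spectralProj hx) (spectralProj_ne_zero hx)
    fun _ _ => spectralProj_mul_spectralProj hx).mul_left (opNorm 2 x)
  have h1 : ∀ μ : Eigenvalue x, ‖μ.1‖ ≤ opNorm 2 x * (opNorm 1 (spectralProj μ))⁻¹ := by
    intro μ
    have hpos := zero_lt_one.trans_le
      (one_le_opNorm_proj (isStarProjection_spectralProj hx μ) (spectralProj_ne_zero hx μ) 1)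
    rw [← div_eq_mul_inv, le_div_iff₀ hpos]
    exact norm_mul_opNorm_proj_le (isStarProjection_spectralProj hx μ) (mul_spectralProj hx μ) 1
  have h2 := hs.tendsto_cofinite_zero.eventually_lt_const hε
  refine (eventually_cofinite.1 h2).subset fun μ hμ => ?_
  exact not_lt.2 (le_trans hμ (h1 μ))

/-- A normal operator is the sum of the series `∑ μ P_μ` whenever the latter converges. -/
theorem eq_of_hasSum_spectralProj (hx : IsStarNormal x) {ι : Type*} (e : ι ≃ Eigenvalue x)
    {y : SmoothOp} (hy : HasSum (fun i => (e i).1 • spectralProj (e i)) y) : y = x := by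
  -- Equality is tested on eigenvectors v of x in ℓ². By orthogonality, at most the term of the
  -- series belonging to the eigenvalue of v survives.
  refine toL2Hom_injective ((isStarNormal_toL2Hom hx).eq_of_eqOn_eigenvectors
    (isCompactOperator_toL2Hom x) fun μ v hv => ?_)
  have h1 : HasSum (fun i => (e i).1 • (eigenspaceL2 x (e i)).starProjection v) (toL2Hom y v) := by
    have h := (hy.map toL2Hom continuous_toL2Hom).mapL (ContinuousLinearMap.apply ℂ L2Seq v)
    refine h.congr_fun fun i => ?_
    rw [Function.comp_apply, map_smul, toL2Hom_spectralProj hx]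
    rfl
  have hzero : ∀ ν : Eigenvalue x, ν.1 ≠ μ → (eigenspaceL2 x ν).starProjection v = 0 := by
    intro ν hν
    rw [Submodule.starProjection_apply_eq_zero_iff]
    refine (Submodule.mem_orthogonal _ _).2 fun w hw => ?_
    exact ((isStarNormal_toL2Hom hx).isOrtho_eigenspace hν).inner_eq hw (mem_eigenspace_iff.2 hv)
  rw [hv]
  refine h1.unique ?_
  by_cases hμ : ∃ i, (e i).1 = μ
  · obtain ⟨i, hi⟩ := hμ
    convert hasSum_single i fun j hj => ?_ using 1
    · rw [Submodule.starProjection_eq_self_iff.2 (mem_eigenspace_iff.2 (hi ▸ hv)), hi]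
    · rw [hzero _ fun h => hj (e.injective (Subtype.ext (h.trans hi.symm))), smul_zero]
  -- No index carries μ, which forces μ = 0 or v = 0; both sides are then 0.
  · push Not at hμ
    have hv0 : μ • v = 0 := by
      by_contra hne
      have hμ0 : μ ≠ 0 := fun h => hne (by rw [h, zero_smul])
      have hv1 : v ≠ 0 := fun h => hne (by rw [h, smul_zero])
      obtain ⟨i, hi⟩ := e.surjective
        ⟨μ, hμ0, hasEigenvalue_of_hasEigenvector ⟨mem_eigenspace_iff.2 hv, hv1⟩⟩
      exact hμ i (congrArg Subtype.val hi)
    rw [hv0]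
    convert hasSum_zero using 1
    funext i
    rw [hzero _ (hμ i), smul_zero]

/-- With finitely many nonzero eigenvalues, x would be a finite sum of operators of finite rank. -/
theorem infinite_eigenvalue (hx : IsStarNormal x) (hinf : x.IsInfiniteDimensional) :
    Infinite (Eigenvalue x) := by
  rw [← not_finite_iff_infinite]
  intro hfin
  have := Fintype.ofFinite (Eigenvalue x)
  have hsum : ∑ μ : Eigenvalue x, μ.1 • spectralProj μ = x :=
    eq_of_hasSum_spectralProj hx (Equiv.refl _) (hasSum_fintype _)
  have hfd := fun μ : Eigenvalue x => finiteDimensional_range_spectralProj hx μ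
  refine hinf ?_
  refine Submodule.finiteDimensional_of_le (S₂ := ⨆ μ : Eigenvalue x,
    LinearMap.range (spectralProj μ : SlowSeq →ₗ[ℂ] RapidSeq)) ?_
  rintro _ ⟨ξ, rfl⟩
  have hsub : ∀ y : SmoothOp, y ∈ Submodule.span ℂ (Set.range fun μ : Eigenvalue x => spectralProj μ) →
      y ξ ∈ ⨆ μ : Eigenvalue x, LinearMap.range (spectralProj μ : SlowSeq →ₗ[ℂ] RapidSeq) := by
    intro y hy
    induction hy using Submodule.span_induction with
    | mem y hy =>
      obtain ⟨μ, rfl⟩ := hy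
      exact Submodule.mem_iSup_of_mem μ ⟨ξ, rfl⟩
    | zero => exact Submodule.zero_mem _
    | add y z _ _ hy hz => exact Submodule.add_mem _ hy hz
    | smul c y _ hy => exact Submodule.smul_mem _ c hy
  refine hsub x ?_
  have hmem := Submodule.sum_mem
    (Submodule.span ℂ (Set.range fun μ : Eigenvalue x => spectralProj μ)) (t := Finset.univ)
    (f := fun μ : Eigenvalue x => μ.1 • spectralProj μ)
    fun μ _ => Submodule.smul_mem _ _ (Submodule.subset_span ⟨μ, rfl⟩)
  rwa [hsum] at hmem

theorem exists_isSpectralRepresentation (hx : IsStarNormal x) (hinf : x.IsInfiniteDimensional) :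
    ∃ (lam : ℕ → ℂ) (P : ℕ → SmoothOp), IsSpectralRepresentation x lam P := by
  have := infinite_eigenvalue hx hinf
  obtain ⟨e, he⟩ := exists_equiv_antitone (fun μ : Eigenvalue x => norm_pos_iff.2 μ.2.1)
    fun ε hε => finite_eigenvalue_norm_ge hx hε
  have horth : ∀ m n, m ≠ n → spectralProj (e m) * spectralProj (e n) = 0 := fun m n hmn =>
    spectralProj_mul_spectralProj hx (e.injective.ne hmn)
  have hP : IsOrthogonalFamily fun n => spectralProj (e n) :=
    ⟨fun n => isStarProjection_spectralProj hx _, fun n => spectralProj_ne_zero hx _, horth⟩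
  obtain ⟨y, hy⟩ := hP.summable (hP.isCoeff_of_mul_proj fun n => mul_spectralProj hx (e n))
  obtain rfl := eq_of_hasSum_spectralProj hx e hy
  exact ⟨fun n => (e n).1, fun n => spectralProj (e n),
    { lam_ne_zero := fun n => (e n).2.1
      lam_injective := Subtype.val_injective.comp e.injective
      lam_antitone := he
      isStarProjection := hP.isStarProjection
      proj_ne_zero := hP.ne_zero
      orthogonal := horth
      finiteDimensional := fun n => not_not.2 (finiteDimensional_range_spectralProj hx _)
      tendsto := hy.tendsto_sum_nat }⟩

end SmoothOp

/-! ### The main theorem -/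

theorem mainTheorem3 (x : SmoothOp) (hx : IsStarNormal x) (hinf : x.IsInfiniteDimensional) :
    (∃ (lam : ℕ → ℂ) (P : ℕ → SmoothOp), IsSpectralRepresentation x lam P) ∧
    ∀ (lam : ℕ → ℂ) (P : ℕ → SmoothOp) (h : IsSpectralRepresentation x lam P),
      IsFrechetAlgebra h.FunctionSpace ∧ IsFrechetAlgebra x.alg ∧
      ∃ Φ : h.FunctionSpace ≃⋆ₐ[ℂ] x.alg,
        Continuous Φ ∧ Continuous Φ.symm ∧
        (∀ f : h.FunctionSpace, HasSum (fun n => f (h.point n) • P n) (Φ f : SmoothOp)) ∧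
        (∃ ι : h.FunctionSpace, (∀ z : quasispectrum ℂ x, ι z = (z : ℂ)) ∧
          (Φ ι : SmoothOp) = x) ∧
        (∀ f : h.FunctionSpace, (Φ (star f) : SmoothOp) = star (Φ f : SmoothOp)) := by
  refine ⟨SmoothOp.exists_isSpectralRepresentation hx hinf, fun lam P h =>
    ⟨h.isFrechetAlgebra_functionSpace, SmoothOp.isFrechetAlgebra_of_isClosed x.alg
      (NonUnitalStarAlgebra.elemental.isClosed ℂ x), h.functionalCalculusEquiv,
      h.continuous_functionalCalculusEquiv, h.continuous_functionalCalculusEquiv_symm,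
      h.hasSum_functionalCalculus, ?_, map_star h.functionalCalculus⟩⟩
  obtain ⟨f, hf, hfx⟩ := h.exists_functionalCalculus_eq_self
  refine ⟨f, fun z => ?_, hfx⟩
  rcases h.eq_zero_or_eq_of_mem_quasispectrum z.2 with hz | ⟨n, hn⟩
  · obtain rfl : z = 0 := Subtype.ext hz
    exact IsSpectralRepresentation.FunctionSpace.toFun_zero_point h f
  · obtain rfl : z = h.point n := Subtype.ext hn
    exact hf n
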